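/- **Theorem 1.3.** Let $m,n\ge 1$, $0<\beta<1$, and for $\vec y=(y_1,\dots,y_m)\in(\mathbb R^n)^m$ write $|\vec y|=|y_1|+\cdots+|y_m|$ and, if $\vec y\neq 0$, $\vec y\,'=\vec y/|\vec y|$. Let $\Omega$ be a real- or complex-valued function on $(\mathbb R^n)^m$ such that (i) $\Omega(\lambda\vec y)=\Omega(\vec y)$ for all $\lambda>0$ and all $\vec y$; (ii) there is $C_0>0$ with $|\Omega(\vec\xi)-\Omega(\vec\eta)|\le C_0\,|\vec\xi\,'-\vec\eta\,'|^{\beta}$ for all $\vec\xi,\vec\eta\ne 0$; (iii) for each $j=1,\dots,m$ and all $y_i\in\mathbb R^n$ ($i\neq j$), $\int_{S^{n-1}}\Omega(y_1,\dots,y_m)\,d\sigma(y_j)=0$, where $\sigma$ is the surface measure of the unit sphere $S^{n-1}$. For $\vec f=(f_1,\dots,f_m)$ (with values in the same scalar field as $\Omega$) and $x\in\mathbb R^n$ let $$F_t(\vec f)(x)=\frac1{t^m}\int_{\{|y_1|\le t,\dots,|y_m|\le t\}}\frac{\Omega(\vec y)}{|\vec y|^{m(n-1)}}\prod_{i=1}^m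 f_i(x-y_i)\,d\vec y,\qquad \mu(\vec f)(x)=\Big(\int_0^\infty|F_t(\vec f)(x)|^2\,\frac{dt}{t}\Big)^{1/2}\in[0,\infty].$$ For $0<\gamma<1$ let $\|g\|_{Lip_\gamma}=\sup_{x\ne z}|g(x)-g(z)|/|x-z|^{\gamma}$ (where $|\infty-a|=\infty$ for finite $a$ and $|\infty-\infty|=0$), and let $Lip_\gamma$ be the space of functions $g$ on $\mathbb R^n$, with values in the same scalar field as $\Omega$, for which this is finite. Let $\alpha_1,\dots,\alpha_m>0$ and suppose that $\alpha=\alpha_1+\cdots+\alpha_m$ satisfies $0<\alpha<\beta/2$. Then there is a constant $C>0$ such that for all $f_j\in Lip_{\alpha_j}$, $j=1,\dots,m$: either $\mu(\vec f)(x)=\infty$ for every $x\in\mathbb R^n$, or $\mu(\vec f)(x)<\infty$ for almost every $x\in\mathbb R^n$, and in the latter case $$\|\mu(\vec f)\|_{Lip_\alpha}\le C\prod_{j=1}^m\|f_j\|_{Lip_{\alpha_j}},$$ where $C$ is independent of $\vec f$. -/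

import Mathlib

open MeasureTheory Set
open scoped NNReal ENNReal

noncomputable section

/-- The paper's size of a point of `(ℝⁿ)ᵐ`: `|y⃗| = |y₁| + ⋯ + |yₘ|`. -/
def sumNorm {n m : ℕ} (y : Fin m → EuclideanSpace ℝ (Fin n)) : ℝ := ∑ i, ‖y i‖

/-- The normalisation `y⃗' = y⃗ / (|y₁| + ⋯ + |yₘ|)`, for `y⃗ ≠ 0`. -/
def sumNormalize {n m : ℕ} (y : Fin m → EuclideanSpace ℝ (Fin n)) :
    Fin m → EuclideanSpace ℝ (Fin n) := (sumNorm y)⁻¹ • y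

/-- The conditions on `Ω : (ℝⁿ)ᵐ → 𝕜`: homogeneity of degree `0`, the Lipschitz condition of
order `β`, and vanishing integral over the unit sphere in each variable. The measure
`volume.toSphere` is the surface measure of `Sⁿ⁻¹` (for `n = 1`, the counting measure of
`{-1, 1}`). -/
structure IsMarcinkiewiczKernel {𝕜 : Type*} [RCLike 𝕜] {n m : ℕ} (β : ℝ)
    (Ω : (Fin m → EuclideanSpace ℝ (Fin n)) → 𝕜) : Prop where
  homogeneous : ∀ (c : ℝ) (y : Fin m → EuclideanSpace ℝ (Fin n)), 0 < c → Ω (c • y) = Ω y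
  lipschitz : ∃ C : ℝ, 0 < C ∧ ∀ ξ η : Fin m → EuclideanSpace ℝ (Fin n), ξ ≠ 0 → η ≠ 0 →
    ‖Ω ξ - Ω η‖ ≤ C * sumNorm (sumNormalize ξ - sumNormalize η) ^ β
  vanishing : ∀ (j : Fin m) (y : Fin m → EuclideanSpace ℝ (Fin n)),
    ∫ θ : Metric.sphere (0 : EuclideanSpace ℝ (Fin n)) 1,
      Ω (Function.update y j (θ : EuclideanSpace ℝ (Fin n)))
        ∂(volume : Measure (EuclideanSpace ℝ (Fin n))).toSphere = 0

/-- `F_t(f⃗)(x) = t⁻ᵐ ∫_{B(0,t)ᵐ} Ω(y⃗) |y⃗|^{-m(n-1)} ∏ᵢ fᵢ(x - yᵢ) dy⃗`, with closed balls. -/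
def marcinkiewiczAverage {𝕜 : Type*} [RCLike 𝕜] {n m : ℕ}
    (Ω : (Fin m → EuclideanSpace ℝ (Fin n)) → 𝕜) (f : Fin m → EuclideanSpace ℝ (Fin n) → 𝕜)
    (t : ℝ) (x : EuclideanSpace ℝ (Fin n)) : 𝕜 :=
  ((t ^ m)⁻¹ : ℝ) •
    ∫ y in {y : Fin m → EuclideanSpace ℝ (Fin n) | ∀ i, y i ∈ Metric.closedBall 0 t},
      ((sumNorm y ^ (m * (n - 1)))⁻¹ : ℝ) • (Ω y * ∏ i, f i (x - y i))

/-- The multilinear Marcinkiewicz integral `μ(f⃗)(x) = (∫₀^∞ |F_t(f⃗)(x)|² dt/t)^{1/2}`, with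
values in `[0, ∞]`. -/
def marcinkiewicz {𝕜 : Type*} [RCLike 𝕜] {n m : ℕ}
    (Ω : (Fin m → EuclideanSpace ℝ (Fin n)) → 𝕜) (f : Fin m → EuclideanSpace ℝ (Fin n) → 𝕜)
    (x : EuclideanSpace ℝ (Fin n)) : ℝ≥0∞ :=
  (∫⁻ t in Ioi (0 : ℝ), ‖marcinkiewiczAverage Ω f t x‖ₑ ^ 2 / ENNReal.ofReal t) ^ (1 / 2 : ℝ)

/-- The norm of `Lip_r`: `sup_{x ≠ z} |g x - g z| / |x - z| ^ r ∈ [0, ∞]`, for functions on `ℝⁿ`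
with values in the scalars or in `[0, ∞]`. In `[0, ∞]` the distance `edist` of two finite values
is the usual one, and that of a finite value to `∞` is `∞`. -/
def lipNorm {Y : Type*} [EDist Y] {n : ℕ} (r : ℝ) (g : EuclideanSpace ℝ (Fin n) → Y) : ℝ≥0∞ :=
  ⨆ (x) (z) (_ : x ≠ z), edist (g x) (g z) / edist x z ^ r

end

/-! Write `P` for the product of the Lipschitz constants of the `fᵢ`, `a` for the sum of their
exponents, and `h = |z - x|`. The theorem follows from `μ(f⃗)(x) ≤ μ(f⃗)(z) + C P h ^ a` for all `x
≠ z` (`exists_marcinkiewicz_le_add`): finiteness at one point then spreads to every point, and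
exchanging `x` and `z` gives the Lipschitz bound.

By Minkowski's inequality in `L²(dt/t)` (`marcinkiewicz_le_add`) it is enough to bound the square
function of `F_t(x) - F_t(z)`. Two estimates are used. Since `Ω` has mean zero on spheres in each
variable, constants may be subtracted from the `fᵢ` (`integral_kernel_mul_prod_sub`), which gives
`|F_t| ≲ P t ^ a` (`norm_average_le`). For `t ≥ h` there is the better bound `|F_t(x) - F_t(z)| ≲ P
h ^ β t ^ (a - β)` (`exists_norm_average_sub_le`). Using the first for `t ≤ h` and the second for `t
> h`, the integral of the square against `dt/t` is of order `(P h ^ a) ^ 2`, because `0 < a < β`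
(`setLIntegral_Ioi_sq_div_le`).

For the second estimate, the same constants `fᵢ x` are subtracted at both points and the integral at
`z` is translated by `d = (z - x, …, z - x)`. Both integrals then carry the same product, and only
the truncated kernel at `y` and at `y + d` is compared (`enorm_truncated_sub_mul_le`). Where both
points lie in the domain, Hölder regularity of the kernel applies; where just one does, it has a
coordinate in a shell of thickness `h`. All size estimates use `|y⃗|^{-m(n-1)} ≤ ∏ |yᵢ|^{-(n-1)}`,
whose integrals factor and become one-dimensional in polar coordinates. -/

theorem lintegral_fin_prod_eq_prod {m : ℕ} {X : Type*} [MeasurableSpace X] {μ : Measure X}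
    [SigmaFinite μ] (φ : Fin m → X → ℝ≥0∞) (hφ : ∀ i, Measurable (φ i)) :
    ∫⁻ y : Fin m → X, ∏ i, φ i (y i) ∂(Measure.pi fun _ => μ) = ∏ i, ∫⁻ v, φ i v ∂μ := by
  induction m with
  | zero => simp
  | succ m ih =>
    rw [← ((measurePreserving_piFinSuccAbove (fun _ : Fin (m + 1) => μ) 0).symm).lintegral_comp_emb
      (MeasurableEquiv.measurableEmbedding _)]
    simp_rw [MeasurableEquiv.piFinSuccAbove_symm_apply, Fin.insertNthEquiv,
        Fin.prod_univ_succ, Fin.insertNth_zero, Equiv.coe_fn_mk, Fin.cons_succ, Fin.cons_zero]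
    rw [← ih _ fun i => hφ _]
    exact lintegral_prod_mul (hφ 0).aemeasurable
      (Finset.measurable_prod _ fun i _ => (hφ _).comp (measurable_pi_apply i)).aemeasurable

/-! ### Polar coordinates -/

section Polar

variable {E : Type*} [NormedAddCommGroup E] [NormedSpace ℝ E] [FiniteDimensional ℝ E]
  [MeasurableSpace E] [BorelSpace E] [Nontrivial E] (μ : Measure E) [μ.IsAddHaarMeasure]

/-- Integration in polar coordinates for a radial function with values in `[0, ∞]`. -/
theorem lintegral_fun_norm_eq (g : ℝ → ℝ≥0∞) (hg : Measurable g) :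
    ∫⁻ x, g ‖x‖ ∂μ = μ.toSphere univ *
      ∫⁻ r in Ioi (0 : ℝ), ENNReal.ofReal (r ^ (Module.finrank ℝ E - 1)) * g r := by
  calc
    ∫⁻ x, g ‖x‖ ∂μ = ∫⁻ x : ({(0)}ᶜ : Set E), g ‖x.1‖ ∂(μ.comap (↑)) := by
      rw [lintegral_subtype_comap (measurableSet_singleton _).compl fun x ↦ g ‖x‖,
        restrict_compl_singleton]
    _ = ∫⁻ x, g x.2 ∂μ.toSphere.prod (.volumeIoiPow (Module.finrank ℝ E - 1)) := by
      simpa using μ.measurePreserving_homeomorphUnitSphereProd.lintegral_comp_emb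
        (Homeomorph.measurableEmbedding _) (g ∘ Subtype.val ∘ Prod.snd)
    _ = μ.toSphere univ * ∫⁻ r : Ioi (0 : ℝ), g r ∂.volumeIoiPow (Module.finrank ℝ E - 1) := by
      have hm : Measurable fun r : Ioi (0 : ℝ) => g r := hg.comp measurable_subtype_coe
      simpa using lintegral_prod_mul (μ := μ.toSphere)
        (ν := .volumeIoiPow (Module.finrank ℝ E - 1))
        (f := fun _ => 1) aemeasurable_const hm.aemeasurable
    _ = _ := by
      congr 1
      rw [Measure.volumeIoiPow, lintegral_withDensity_eq_lintegral_mul _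
        (by fun_prop) (g := fun r : Ioi (0 : ℝ) => g r) (hg.comp measurable_subtype_coe)]
      exact lintegral_subtype_comap measurableSet_Ioi
        fun r => ENNReal.ofReal (r ^ (Module.finrank ℝ E - 1)) * g r

/-- The weight cancels the Jacobian `r ^ (dim - 1)`, so the radial variable is left with plain
Lebesgue measure. -/
theorem lintegral_inv_enorm_pow_mul_eq (ψ : ℝ → ℝ≥0∞) (hψ : Measurable ψ) :
    ∫⁻ x, (‖x‖ₑ ^ (Module.finrank ℝ E - 1))⁻¹ * ψ ‖x‖ ∂μ =
      μ.toSphere univ * ∫⁻ r in Ioi (0 : ℝ), ψ r := by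
  have h := lintegral_fun_norm_eq μ
    (fun r => (ENNReal.ofReal r ^ (Module.finrank ℝ E - 1))⁻¹ * ψ r) (by fun_prop)
  simp only [ofReal_norm] at h
  rw [h]
  congr 1
  refine setLIntegral_congr_fun measurableSet_Ioi fun r hr => ?_
  have hr' : 0 < r := hr

  rw [ENNReal.ofReal_pow hr'.le, ← mul_assoc, ENNReal.mul_inv_cancel, one_mul]
  · exact pow_ne_zero _ (by simpa using hr')
  · exact ENNReal.pow_ne_top ENNReal.ofReal_ne_top

/-- A function whose integrals over all spheres around the origin vanish has integral zero. -/
theorem integral_eq_zero_of_sphere {F : Type*} [NormedAddCommGroup F] [NormedSpace ℝ F]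
    (Φ : E → F)
    (h : ∀ r : ℝ, 0 < r → ∫ θ : Metric.sphere (0 : E) 1, Φ (r • (θ : E)) ∂μ.toSphere = 0) :
    ∫ x, Φ x ∂μ = 0 := by
  have h1 : ∫ x, Φ x ∂μ = ∫ p : Metric.sphere (0 : E) 1 × Ioi (0 : ℝ), Φ (p.2.1 • p.1.1)
      ∂μ.toSphere.prod (.volumeIoiPow (Module.finrank ℝ E - 1)) := by
    have h2 := μ.measurePreserving_homeomorphUnitSphereProd.integral_comp
      (Homeomorph.measurableEmbedding _)
      (fun p : Metric.sphere (0 : E) 1 × Ioi (0 : ℝ) => Φ (p.2.1 • p.1.1))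
    have h3 := integral_subtype_comap (μ := μ) (measurableSet_singleton (0 : E)).compl Φ
    rw [restrict_compl_singleton] at h3
    rw [← h2, ← h3]
    congr 1 with x
    simp only [homeomorphUnitSphereProd_apply_snd_coe, homeomorphUnitSphereProd_apply_fst_coe]
    rw [smul_smul, mul_inv_cancel₀ (norm_ne_zero_iff.2 x.2), one_smul]
  rw [h1]
  by_cases hi : Integrable (fun p : Metric.sphere (0 : E) 1 × Ioi (0 : ℝ) => Φ (p.2.1 • p.1.1))
      (μ.toSphere.prod (.volumeIoiPow (Module.finrank ℝ E - 1)))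
  · rw [integral_prod_symm _ hi]
    simp [fun r : Ioi (0 : ℝ) => h r.1 r.2]
  -- The Bochner integral of a non-integrable function is `0`, so no integrability hypothesis is
  -- needed.
  · exact integral_undef hi

end Polar

/-! ### The kernel and its cancellation -/

section Marcinkiewicz

variable {𝕜 : Type*} [RCLike 𝕜] {n m : ℕ}

/-- The integral kernel `Ω(y⃗) |y⃗|^{-m(n-1)}`. -/
noncomputable def marcinkiewiczKernel (Ω : (Fin m → EuclideanSpace ℝ (Fin n)) → 𝕜)
    (y : Fin m → EuclideanSpace ℝ (Fin n)) : 𝕜 :=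
  ((sumNorm y ^ (m * (n - 1)))⁻¹ : ℝ) • Ω y

/-- The product of `m` closed balls of radius `t` around `0`. -/
def polyball (n m : ℕ) (t : ℝ) : Set (Fin m → EuclideanSpace ℝ (Fin n)) :=
  {y | ∀ i, y i ∈ Metric.closedBall 0 t}

theorem measurableSet_polyball (t : ℝ) : MeasurableSet (polyball n m t) := by
  have : polyball n m t = Set.pi univ fun _ => Metric.closedBall 0 t := by
    ext; simp [polyball]
  rw [this]
  exact .univ_pi fun _ => measurableSet_closedBall

theorem mem_polyball {t : ℝ} {y : Fin m → EuclideanSpace ℝ (Fin n)} :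
    y ∈ polyball n m t ↔ ∀ i, ‖y i‖ ≤ t := by
  simp [polyball]

/-- With the other variables fixed and `‖y j‖ = r`, the cut-off, the factor `|y⃗|^{-m(n-1)}` and `Φ`
are all constant, so the spherical mean of `Ω` in the `j`-th variable is all that remains. -/
theorem IsMarcinkiewiczKernel.integral_mul_eq_zero [NeZero n] {β : ℝ}
    {Ω : (Fin m → EuclideanSpace ℝ (Fin n)) → 𝕜} (hΩ : IsMarcinkiewiczKernel β Ω) (t : ℝ)
    (j : Fin m) (Φ : (Fin m → EuclideanSpace ℝ (Fin n)) → 𝕜)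
    (hΦ : ∀ y v, Φ (Function.update y j v) = Φ y) :
    ∫ y in polyball n m t, marcinkiewiczKernel Ω y * Φ y = 0 := by
  obtain ⟨m, rfl⟩ : ∃ k, m = k + 1 := Nat.exists_eq_add_one.2 j.pos
  rw [← integral_indicator (measurableSet_polyball t)]
  rw [← (volume_preserving_piFinSuccAbove
    (fun _ : Fin (m + 1) => EuclideanSpace ℝ (Fin n)) j).symm.integral_comp'
    (g := (polyball n (m + 1) t).indicator fun y => marcinkiewiczKernel Ω y * Φ y)]
  rw [Measure.volume_eq_prod]
  set H : EuclideanSpace ℝ (Fin n) × (Fin m → EuclideanSpace ℝ (Fin n)) → 𝕜 := fun p =>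
    (polyball n (m + 1) t).indicator (fun y => marcinkiewiczKernel Ω y * Φ y)
      ((MeasurableEquiv.piFinSuccAbove (fun _ => EuclideanSpace ℝ (Fin n)) j).symm p) with hH
  change ∫ p, H p ∂_ = 0
  by_cases hi : Integrable H (volume.prod volume)
  swap
  · exact integral_undef hi
  rw [integral_prod_symm _ hi]
  refine integral_eq_zero_of_ae (.of_forall fun w => ?_)
  refine integral_eq_zero_of_sphere _ _ fun r hr => ?_
  set y₀ : Fin (m + 1) → EuclideanSpace ℝ (Fin n) := j.insertNth 0 w
  have hy : ∀ v, (MeasurableEquiv.piFinSuccAbove (fun _ => EuclideanSpace ℝ (Fin n)) j).symm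
      (v, w) = Function.update y₀ j v := by
    intro v
    simp [y₀, MeasurableEquiv.piFinSuccAbove_symm_apply, Fin.insertNthEquiv]
  -- The vanishing condition concerns the unit sphere only; homogeneity moves the sphere of radius
  -- `r` there, at the price of rescaling the other variables by `r⁻¹`.
  have hup : ∀ θ : EuclideanSpace ℝ (Fin n), Function.update y₀ j (r • θ) =
      r • Function.update (r⁻¹ • y₀) j θ := by
    intro θ
    ext i : 1
    by_cases hij : i = j
    · subst hij; simp
    · simp [hij, smul_smul, hr.ne']
  have hform : ∀ θ : Metric.sphere (0 : EuclideanSpace ℝ (Fin n)) 1,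
      H (r • (θ : EuclideanSpace ℝ (Fin n)), w) =
      ((if r ≤ t ∧ ∀ i, ‖w i‖ ≤ t then
        (((r + ∑ i, ‖w i‖) ^ ((m + 1) * (n - 1)))⁻¹ : ℝ) else 0 : ℝ) * Φ y₀) *
        Ω (Function.update (r⁻¹ • y₀) j θ) := by
    intro θ
    have hn : ‖r • (θ : EuclideanSpace ℝ (Fin n))‖ = r := by
      rw [norm_smul, mem_sphere_zero_iff_norm.1 θ.2, mul_one, Real.norm_of_nonneg hr.le]
    have hs : sumNorm (Function.update y₀ j (r • (θ : EuclideanSpace ℝ (Fin n)))) =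
        r + ∑ i, ‖w i‖ := by
      rw [sumNorm, Fin.sum_univ_succAbove _ j]
      simp [y₀, hn]
    have hmem : Function.update y₀ j (r • (θ : EuclideanSpace ℝ (Fin n))) ∈
        polyball n (m + 1) t ↔ r ≤ t ∧ ∀ i, ‖w i‖ ≤ t := by
      rw [mem_polyball, Fin.forall_iff_succAbove j]
      simp only [Function.update_self, hn]
      simp [y₀]
    simp only [hH, hy]
    by_cases hc : r ≤ t ∧ ∀ i, ‖w i‖ ≤ t
    · rw [indicator_of_mem (hmem.2 hc), if_pos hc, marcinkiewiczKernel, hs, hΦ, hup,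
        hΩ.homogeneous _ _ hr, RCLike.real_smul_eq_coe_mul]
      ring
    · rw [indicator_of_notMem (fun h => hc (hmem.1 h)), if_neg hc]
      simp
  simp_rw [hform]
  rw [integral_const_mul, hΩ.vanishing, mul_zero]

/-! ### The size `|y⃗|` and the regularity of the kernel -/

theorem sumNorm_nonneg (y : Fin m → EuclideanSpace ℝ (Fin n)) : 0 ≤ sumNorm y :=
  Finset.sum_nonneg fun _ _ => norm_nonneg _

theorem norm_le_sumNorm (y : Fin m → EuclideanSpace ℝ (Fin n)) (i : Fin m) :
    ‖y i‖ ≤ sumNorm y :=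
  Finset.single_le_sum (f := fun i => ‖y i‖) (fun _ _ => norm_nonneg _) (Finset.mem_univ i)

theorem sumNorm_eq_zero {y : Fin m → EuclideanSpace ℝ (Fin n)} : sumNorm y = 0 ↔ y = 0 := by
  rw [sumNorm, Finset.sum_eq_zero_iff_of_nonneg fun _ _ => norm_nonneg _]
  simp [funext_iff]

theorem sumNorm_pos {y : Fin m → EuclideanSpace ℝ (Fin n)} : 0 < sumNorm y ↔ y ≠ 0 := by
  rw [(sumNorm_nonneg y).lt_iff_ne', Ne, sumNorm_eq_zero]

theorem sumNorm_add_le (y z : Fin m → EuclideanSpace ℝ (Fin n)) :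
    sumNorm (y + z) ≤ sumNorm y + sumNorm z := by
  rw [sumNorm, sumNorm, sumNorm, ← Finset.sum_add_distrib]
  exact Finset.sum_le_sum fun i _ => norm_add_le _ _

theorem sumNorm_smul (c : ℝ) (y : Fin m → EuclideanSpace ℝ (Fin n)) :
    sumNorm (c • y) = |c| * sumNorm y := by
  simp [sumNorm, norm_smul, Finset.mul_sum]

theorem sumNorm_neg (y : Fin m → EuclideanSpace ℝ (Fin n)) : sumNorm (-y) = sumNorm y := by
  simp [sumNorm]

theorem sumNorm_sub_le (y z : Fin m → EuclideanSpace ℝ (Fin n)) :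
    sumNorm (y - z) ≤ sumNorm y + sumNorm z := by
  rw [sub_eq_add_neg, ← sumNorm_neg z]
  exact sumNorm_add_le _ _

theorem abs_sumNorm_add_sub_le (y d : Fin m → EuclideanSpace ℝ (Fin n)) :
    |sumNorm (y + d) - sumNorm y| ≤ sumNorm d := by
  rw [abs_le]
  have h1 := sumNorm_add_le y d
  have h2 := sumNorm_sub_le (y + d) d
  rw [add_sub_cancel_right] at h2
  constructor <;> linarith

theorem sumNorm_sumNormalize {y : Fin m → EuclideanSpace ℝ (Fin n)} (hy : y ≠ 0) :
    sumNorm (sumNormalize y) = 1 := by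
  have h := sumNorm_pos.2 hy
  rw [sumNormalize, sumNorm_smul, abs_of_pos (inv_pos.2 h), inv_mul_cancel₀ h.ne']

theorem continuous_sumNorm :
    Continuous (sumNorm : (Fin m → EuclideanSpace ℝ (Fin n)) → ℝ) := by
  unfold sumNorm
  fun_prop

theorem sumNorm_sumNormalize_sub_le {y d : Fin m → EuclideanSpace ℝ (Fin n)} (hy : y ≠ 0)
    (hyd : y + d ≠ 0) :
    sumNorm (sumNormalize y - sumNormalize (y + d)) ≤ 2 * (sumNorm d / sumNorm y) := by
  have hr := sumNorm_pos.2 hy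
  have hs := sumNorm_pos.2 hyd
  -- Each of the two terms has size at most `|d| / |y|`, whence the factor `2`.
  have h1 : sumNormalize y - sumNormalize (y + d) =
      ((sumNorm y)⁻¹ - (sumNorm (y + d))⁻¹) • (y + d) - (sumNorm y)⁻¹ • d := by
    rw [sumNormalize, sumNormalize]
    module
  rw [h1]
  refine (sumNorm_sub_le _ _).trans ?_
  rw [sumNorm_smul, sumNorm_smul, abs_of_pos (inv_pos.2 hr), inv_sub_inv hr.ne' hs.ne', abs_div,
    abs_of_pos (mul_pos hr hs)]
  have h2 : |sumNorm (y + d) - sumNorm y| / (sumNorm y * sumNorm (y + d)) * sumNorm (y + d) =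
      |sumNorm (y + d) - sumNorm y| / sumNorm y := by
    field_simp
  rw [h2, two_mul, ← div_eq_inv_mul]
  gcongr
  exact abs_sumNorm_add_sub_le y d

/-- After factoring out `(r ^ N)⁻¹`, this compares the `N`-th powers of `1` and `r / s`, both at
most `2`. -/
theorem abs_inv_pow_sub_inv_pow_le (N : ℕ) {r s : ℝ} (hr : 0 < r) (hs : r / 2 ≤ s) :
    |(r ^ N)⁻¹ - (s ^ N)⁻¹| ≤ N * 2 ^ N * (|s - r| / r) * (r ^ N)⁻¹ := by
  have hs0 : 0 < s := by linarith
  have h1 : (r ^ N)⁻¹ - (s ^ N)⁻¹ = (1 ^ N - (r / s) ^ N) * (r ^ N)⁻¹ := by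
    rw [div_pow]
    field_simp
    ring
  have h2 : r / s ≤ 2 := by rw [div_le_iff₀ hs0]; linarith
  rw [h1, abs_mul, abs_of_pos (a := (r ^ N)⁻¹) (by positivity)]
  refine mul_le_mul_of_nonneg_right ?_ (by positivity)
  refine (abs_pow_sub_pow_le (1 : ℝ) (r / s) N).trans ?_
  have h3 : |1 - r / s| ≤ 2 * (|s - r| / r) := by
    have : 1 - r / s = (s - r) / r * (r / s) := by field_simp
    rw [this, abs_mul, abs_div, abs_of_pos hr, abs_of_pos (div_pos hr hs0), mul_comm]
    gcongr
  have h4 : max |(1 : ℝ)| |r / s| ≤ 2 := by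
    rw [abs_of_pos (div_pos hr hs0), abs_one]
    exact max_le one_le_two h2
  cases N with
  | zero => simp
  | succ N =>
    rw [Nat.add_sub_cancel]
    calc |1 - r / s| * ((N + 1 : ℕ) : ℝ) * max |(1 : ℝ)| |r / s| ^ N
        ≤ (2 * (|s - r| / r)) * ((N + 1 : ℕ) : ℝ) * 2 ^ N := by gcongr
      _ = _ := by ring

namespace IsMarcinkiewiczKernel

variable {β : ℝ} {Ω : (Fin m → EuclideanSpace ℝ (Fin n)) → 𝕜}

/-- Normalised points are at distance at most `2`, so one reference point controls all nonzero ones.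
The Hölder condition says nothing about `Ω 0`, which is added separately. -/
theorem exists_norm_le (hΩ : IsMarcinkiewiczKernel β Ω) (hβ : 0 < β) :
    ∃ A : ℝ, 0 < A ∧ ∀ y, ‖Ω y‖ ≤ A := by
  obtain ⟨C, hC, h⟩ := hΩ.lipschitz
  by_cases he : ∃ e : Fin m → EuclideanSpace ℝ (Fin n), e ≠ 0
  · obtain ⟨e, he⟩ := he
    refine ⟨‖Ω 0‖ + (‖Ω e‖ + C * 2 ^ β), by positivity, fun y => ?_⟩
    by_cases hy : y = 0
    · subst hy
      exact le_add_of_nonneg_right (by positivity)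
    · have h1 := h y e hy he
      have h2 : sumNorm (sumNormalize y - sumNormalize e) ^ β ≤ 2 ^ β := by
        refine Real.rpow_le_rpow (sumNorm_nonneg _) ?_ hβ.le
        refine (sumNorm_sub_le _ _).trans ?_
        rw [sumNorm_sumNormalize hy, sumNorm_sumNormalize he]
        norm_num
      have h3 := norm_le_norm_add_norm_sub' (Ω y) (Ω e)
      have h4 := mul_le_mul_of_nonneg_left h2 hC.le
      have h5 := norm_nonneg (Ω 0)
      linarith
  · push Not at he
    refine ⟨‖Ω 0‖ + 1, by positivity, fun y => ?_⟩
    rw [he y]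
    linarith

theorem continuousOn (hΩ : IsMarcinkiewiczKernel β Ω) (hβ : 0 < β) :
    ContinuousOn Ω {0}ᶜ := by
  obtain ⟨C, hC, h⟩ := hΩ.lipschitz
  intro y hy
  refine ContinuousAt.continuousWithinAt ?_
  rw [ContinuousAt, tendsto_iff_norm_sub_tendsto_zero]
  have hc : ContinuousAt (fun z : Fin m → EuclideanSpace ℝ (Fin n) =>
      C * sumNorm (sumNormalize z - sumNormalize y) ^ β) y := by
    have h1 : ContinuousAt
        (sumNormalize : _ → Fin m → EuclideanSpace ℝ (Fin n)) y :=
      (continuous_sumNorm.continuousAt.inv₀ (sumNorm_pos.2 hy).ne').smul continuousAt_id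
    have h2 : ContinuousAt (fun z => sumNorm (sumNormalize z - sumNormalize y)) y :=
      continuous_sumNorm.continuousAt.comp (h1.sub continuousAt_const)
    exact continuousAt_const.mul (h2.rpow_const (Or.inr hβ.le))
  have h0 : C * sumNorm (sumNormalize y - sumNormalize y) ^ β = 0 := by
    rw [sub_self, sumNorm_eq_zero.2 rfl, Real.zero_rpow hβ.ne', mul_zero]
  rw [ContinuousAt, h0] at hc
  refine squeeze_zero' (.of_forall fun _ => norm_nonneg _) ?_ hc
  filter_upwards [isOpen_compl_singleton.mem_nhds hy] with z hz using h z y hz hy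

theorem measurable_kernel (hΩ : IsMarcinkiewiczKernel β Ω) (hβ : 0 < β) :
    Measurable (marcinkiewiczKernel Ω) := by
  have h1 : Measurable Ω := measurable_of_continuousOn_compl_singleton 0 (hΩ.continuousOn hβ)
  have h2 := (continuous_sumNorm (n := n) (m := m)).measurable
  unfold marcinkiewiczKernel
  fun_prop

theorem norm_kernel_le {A : ℝ} (hA : ∀ y, ‖Ω y‖ ≤ A) (y : Fin m → EuclideanSpace ℝ (Fin n)) :
    ‖marcinkiewiczKernel Ω y‖ ≤ A * (sumNorm y ^ (m * (n - 1)))⁻¹ := by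
  rw [marcinkiewiczKernel, norm_smul, mul_comm, Real.norm_of_nonneg]
  · exact mul_le_mul_of_nonneg_right (hA y) (inv_nonneg.2 (pow_nonneg (sumNorm_nonneg y) _))
  · exact inv_nonneg.2 (pow_nonneg (sumNorm_nonneg y) _)

/-- Hölder regularity of the kernel away from the origin. -/
theorem exists_norm_kernel_sub_le (hΩ : IsMarcinkiewiczKernel β Ω) (hβ₀ : 0 < β) (hβ₁ : β ≤ 1) :
    ∃ C : ℝ, 0 < C ∧ ∀ y d : Fin m → EuclideanSpace ℝ (Fin n), y ≠ 0 →
      2 * sumNorm d ≤ sumNorm y →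
      ‖marcinkiewiczKernel Ω y - marcinkiewiczKernel Ω (y + d)‖ ≤
        C * (sumNorm d / sumNorm y) ^ β * (sumNorm y ^ (m * (n - 1)))⁻¹ := by
  obtain ⟨A, hA0, hA⟩ := hΩ.exists_norm_le hβ₀
  obtain ⟨C, hC, h⟩ := hΩ.lipschitz
  set N := m * (n - 1) with hN
  refine ⟨A * (N * 2 ^ N) + C * 2 ^ β * 2 ^ N, by positivity, fun y d hy hd => ?_⟩
  have hr := sumNorm_pos.2 hy
  have habs := abs_sumNorm_add_sub_le y d
  have hs : sumNorm y / 2 ≤ sumNorm (y + d) := by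
    have := (abs_le.1 habs).1
    linarith
  have hs0 : 0 < sumNorm (y + d) := by linarith
  have hyd : y + d ≠ 0 := sumNorm_pos.1 hs0
  set r := sumNorm y
  set s := sumNorm (y + d)
  set q := sumNorm d / r with hq
  have hq0 : 0 ≤ q := div_nonneg (sumNorm_nonneg d) hr.le
  have hq1 : q ≤ 1 := by
    rw [hq, div_le_one hr]
    linarith [sumNorm_nonneg d]
  have hqβ : q ≤ q ^ β := Real.self_le_rpow_of_le_one hq0 hq1 hβ₁
  have e1 : marcinkiewiczKernel Ω y - marcinkiewiczKernel Ω (y + d) =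
      ((r ^ N)⁻¹ - (s ^ N)⁻¹) • Ω y + (s ^ N)⁻¹ • (Ω y - Ω (y + d)) := by
    simp only [marcinkiewiczKernel]
    module
  rw [e1]
  refine (norm_add_le _ _).trans ?_
  rw [norm_smul, norm_smul, Real.norm_eq_abs, Real.norm_of_nonneg (by positivity : 0 ≤ (s ^ N)⁻¹)]
  have b1 : |(r ^ N)⁻¹ - (s ^ N)⁻¹| * ‖Ω y‖ ≤ (N * 2 ^ N * q ^ β * (r ^ N)⁻¹) * A := by
    gcongr
    · refine (abs_inv_pow_sub_inv_pow_le N hr hs).trans ?_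
      gcongr
      refine le_trans ?_ hqβ
      rw [hq]
      gcongr
    · exact hA y
  have b2 : (s ^ N)⁻¹ ≤ 2 ^ N * (r ^ N)⁻¹ := by
    have : (s ^ N)⁻¹ ≤ ((r / 2) ^ N)⁻¹ := by gcongr
    refine this.trans_eq ?_
    rw [div_pow, inv_div, div_eq_mul_inv]
  have b3 : ‖Ω y - Ω (y + d)‖ ≤ C * (2 ^ β * q ^ β) := by
    refine (h y (y + d) hy hyd).trans ?_
    rw [← Real.mul_rpow zero_le_two hq0]
    gcongr
    · exact sumNorm_nonneg _
    · exact sumNorm_sumNormalize_sub_le hy hyd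
  have b4 := mul_le_mul b2 b3 (norm_nonneg _) (by positivity)
  calc _ ≤ (N * 2 ^ N * q ^ β * (r ^ N)⁻¹) * A + 2 ^ N * (r ^ N)⁻¹ * (C * (2 ^ β * q ^ β)) :=
        add_le_add b1 b4
    _ = _ := by ring

/-- The factor `|y| ^ a` is the size of the product of the differences of the `fᵢ`. Far from the
origin Hölder regularity applies; when `|y| < 2|d|` each kernel is bounded by its size, and powers
of `|d|` are traded for the negative power `a - β`. The two terms on the right are one function
taken at `y` and at `y + d`, so they have equal integrals. -/
theorem exists_norm_kernel_sub_mul_le (hΩ : IsMarcinkiewiczKernel β Ω) (hβ₀ : 0 < β)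
    (hβ₁ : β ≤ 1) :
    ∃ C : ℝ, 0 < C ∧ ∀ a : ℝ, 0 < a → a < β →
      ∀ y d : Fin m → EuclideanSpace ℝ (Fin n), y ≠ 0 → y + d ≠ 0 →
      ‖marcinkiewiczKernel Ω y - marcinkiewiczKernel Ω (y + d)‖ * sumNorm y ^ a ≤
        C * sumNorm d ^ β * ((sumNorm y ^ (m * (n - 1)))⁻¹ * sumNorm y ^ (a - β) +
          (sumNorm (y + d) ^ (m * (n - 1)))⁻¹ * sumNorm (y + d) ^ (a - β)) := by
  obtain ⟨A, hA0, hA⟩ := hΩ.exists_norm_le hβ₀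
  obtain ⟨C, hC, h⟩ := hΩ.exists_norm_kernel_sub_le hβ₀ hβ₁
  refine ⟨C + A * 3 ^ β, by positivity, fun a ha haβ y d hy hyd => ?_⟩
  have hr := sumNorm_pos.2 hy
  have hs := sumNorm_pos.2 hyd
  have hH := sumNorm_nonneg d
  have hK1 := norm_kernel_le hA y
  have hK2 := norm_kernel_le hA (y + d)
  have hd := h y d hy
  have habs := abs_le.1 (abs_sumNorm_add_sub_le y d)
  set r := sumNorm y
  set s := sumNorm (y + d)
  set H := sumNorm d
  set R := (r ^ (m * (n - 1)))⁻¹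
  set T := (s ^ (m * (n - 1)))⁻¹
  have hR : 0 ≤ R := by positivity
  have hT : 0 ≤ T := by positivity
  have hra : r ^ a = r ^ (a - β) * r ^ β := by rw [← Real.rpow_add hr]; congr 1; ring
  have hHβ : 0 ≤ H ^ β := Real.rpow_nonneg hH _
  have p1 : 0 ≤ r ^ (a - β) := by positivity
  have p2 : 0 ≤ s ^ (a - β) := by positivity
  rcases le_or_gt (2 * H) r with hfar | hnear
  · have h1 : r ^ a * (H / r) ^ β = H ^ β * r ^ (a - β) := by
      rw [Real.div_rpow hH hr.le, hra]
      field_simp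
    calc _ ≤ C * (H / r) ^ β * R * r ^ a := by gcongr; exact hd hfar
      _ = C * H ^ β * (R * r ^ (a - β)) := by linear_combination C * R * h1
      _ ≤ _ := by
        gcongr
        · exact le_add_of_nonneg_right (by positivity)
        · exact le_add_of_nonneg_right (by positivity)
  · have hH0 : 0 < H := by linarith
    -- Since `a - β < 0`, this upper bound on `s` bounds `s ^ (a - β)` from below.
    have h3 : s ≤ 3 * H := by linarith
    have h4 : r ^ a ≤ 3 ^ β * H ^ β * r ^ (a - β) := by
      rw [hra, mul_comm, ← Real.mul_rpow (by norm_num) hH]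
      gcongr
      linarith
    have h5 : r ^ a ≤ 3 ^ β * H ^ β * s ^ (a - β) := by
      calc r ^ a ≤ (3 * H) ^ a := by gcongr; linarith
        _ = (3 * H) ^ β * (3 * H) ^ (a - β) := by
          rw [← Real.rpow_add (by positivity)]; congr 1; ring
        _ ≤ (3 * H) ^ β * s ^ (a - β) := by
          refine mul_le_mul_of_nonneg_left ?_ (by positivity)
          exact Real.rpow_le_rpow_of_nonpos hs h3 (by linarith)
        _ = _ := by rw [Real.mul_rpow (by norm_num) hH]
    calc _ ≤ (A * R + A * T) * r ^ a := by
          gcongr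
          exact (norm_sub_le _ _).trans (add_le_add hK1 hK2)
      _ = A * R * r ^ a + A * T * r ^ a := by ring
      _ ≤ A * R * (3 ^ β * H ^ β * r ^ (a - β)) + A * T * (3 ^ β * H ^ β * s ^ (a - β)) := by
        gcongr
      _ = (A * 3 ^ β) * H ^ β * (R * r ^ (a - β) + T * s ^ (a - β)) := by ring
      _ ≤ _ := by
        gcongr
        exact le_add_of_nonneg_left hC.le

end IsMarcinkiewiczKernel

/-! ### Weighted integrals over products of balls -/

/-- The weight `∏ᵢ |yᵢ|^{-(n-1)}`, which dominates `|y⃗|^{-m(n-1)}`. -/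
noncomputable def productWeight (y : Fin m → EuclideanSpace ℝ (Fin n)) : ℝ≥0∞ :=
  ∏ i, (‖y i‖ₑ ^ (n - 1))⁻¹

theorem measurable_productWeight :
    Measurable (productWeight : (Fin m → EuclideanSpace ℝ (Fin n)) → ℝ≥0∞) := by
  unfold productWeight
  fun_prop

theorem ofReal_inv_sumNorm_pow_le (y : Fin m → EuclideanSpace ℝ (Fin n)) :
    ENNReal.ofReal (sumNorm y ^ (m * (n - 1)))⁻¹ ≤ productWeight y := by
  -- If the power vanishes, its real inverse is `0` and the left side is trivial.
  rcases eq_or_lt_of_le (pow_nonneg (sumNorm_nonneg y) (m * (n - 1))) with h0 | hpos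
  · rw [← h0]
    simp
  rw [ENNReal.ofReal_inv_of_pos hpos, productWeight, ← ENNReal.prod_inv_distrib, ENNReal.inv_le_inv]
  · calc ∏ i, ‖y i‖ₑ ^ (n - 1) ≤ ∏ _i : Fin m, ENNReal.ofReal (sumNorm y) ^ (n - 1) := by
          gcongr with i
          rw [← ofReal_norm]
          exact ENNReal.ofReal_le_ofReal (norm_le_sumNorm y i)
      _ = _ := by
          rw [Finset.prod_const, Finset.card_univ, Fintype.card_fin, ← pow_mul, mul_comm,
            ENNReal.ofReal_pow (sumNorm_nonneg y)]
  · intro i _ j _ _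
    exact Or.inr (ENNReal.pow_ne_top enorm_ne_top)

theorem setLIntegral_productWeight_mul [NeZero n] (t : ℝ) (j : Fin m) (ψ : ℝ → ℝ≥0∞)
    (hψ : Measurable ψ) :
    ∫⁻ y in polyball n m t, productWeight y * ψ ‖y j‖ =
      ((volume : Measure (EuclideanSpace ℝ (Fin n))).toSphere univ * ENNReal.ofReal t) ^ (m - 1) *
      ((volume : Measure (EuclideanSpace ℝ (Fin n))).toSphere univ *
        ∫⁻ r in Ioc 0 t, ψ r) := by
  classical
  -- The cut-off to the product of balls splits into one factor per coordinate; only the `j`-th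
  -- factor carries `ψ`.
  set χ : Fin m → ℝ → ℝ≥0∞ := fun i => (Iic t).indicator (if i = j then ψ else 1) with hχ
  have hχm : ∀ i, Measurable (χ i) := by
    intro i
    refine Measurable.indicator ?_ measurableSet_Iic
    split_ifs
    · exact hψ
    · exact measurable_one
  have h1 : ∀ y : Fin m → EuclideanSpace ℝ (Fin n),
      (polyball n m t).indicator (fun y => productWeight y * ψ ‖y j‖) y =
      ∏ i, ((‖y i‖ₑ ^ (n - 1))⁻¹ * χ i ‖y i‖) := by
    intro y
    rw [Finset.prod_mul_distrib]
    by_cases hy : y ∈ polyball n m t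
    · rw [indicator_of_mem hy, productWeight]
      congr 1
      rw [Finset.prod_eq_single j]
      · simp [hχ, mem_polyball.1 hy j]
      · intro i _ hij
        simp [hχ, hij, mem_polyball.1 hy i]
      · simp
    · rw [indicator_of_notMem hy]
      rw [mem_polyball] at hy
      push Not at hy
      obtain ⟨i, hi⟩ := hy
      rw [Finset.prod_eq_zero (i := i) (f := fun i => χ i ‖y i‖) (Finset.mem_univ i), mul_zero]
      simp [hχ, hi]
  have h2 : ∀ i, ∫⁻ r in Ioi (0 : ℝ), χ i r = if i = j then ∫⁻ r in Ioc 0 t, ψ r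
      else ENNReal.ofReal t := by
    intro i
    rw [setLIntegral_indicator measurableSet_Iic, inter_comm, Ioi_inter_Iic]
    split_ifs
    · rfl
    · simp
  have h3 := fun i => lintegral_inv_enorm_pow_mul_eq
    (volume : Measure (EuclideanSpace ℝ (Fin n))) (χ i) (hχm i)
  simp only [finrank_euclideanSpace, Fintype.card_fin, h2] at h3
  rw [← lintegral_indicator (measurableSet_polyball t), lintegral_congr h1, volume_pi,
    lintegral_fin_prod_eq_prod (fun i (v : EuclideanSpace ℝ (Fin n)) =>
      (‖v‖ₑ ^ (n - 1))⁻¹ * χ i ‖v‖) fun i => by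
        have := hχm i
        fun_prop]
  rw [Finset.prod_congr rfl fun i _ => h3 i, ← Finset.mul_prod_erase _ _ (Finset.mem_univ j),
    if_pos rfl, mul_comm]
  congr 1
  rw [Finset.prod_congr rfl (g := fun _ =>
    (volume : Measure (EuclideanSpace ℝ (Fin n))).toSphere univ * ENNReal.ofReal t)]
  · rw [Finset.prod_const, Finset.card_erase_of_mem (Finset.mem_univ j)]
    simp
  · intro i hi
    rw [if_neg (Finset.ne_of_mem_erase hi)]

/-- The area of the unit sphere. -/
noncomputable def sphereArea (n : ℕ) : ℝ :=
  ((volume : Measure (EuclideanSpace ℝ (Fin n))).toSphere univ).toReal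

theorem ofReal_sphereArea (n : ℕ) : ENNReal.ofReal (sphereArea n) =
    (volume : Measure (EuclideanSpace ℝ (Fin n))).toSphere univ :=
  ENNReal.ofReal_toReal (measure_ne_top _ _)

theorem sphereArea_nonneg (n : ℕ) : 0 ≤ sphereArea n := ENNReal.toReal_nonneg

theorem setLIntegral_productWeight_mul_of_eq [NeZero n] {t : ℝ} (ht : 0 ≤ t) (j : Fin m)
    (ψ : ℝ → ℝ≥0∞) (hψ : Measurable ψ) {b : ℝ} (hb : ∫⁻ r in Ioc 0 t, ψ r = ENNReal.ofReal b) :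
    ∫⁻ y in polyball n m t, productWeight y * ψ ‖y j‖ =
      ENNReal.ofReal (sphereArea n ^ m * t ^ (m - 1) * b) := by
  have hS := sphereArea_nonneg n
  rw [setLIntegral_productWeight_mul t j ψ hψ, hb, ← ofReal_sphereArea, ← ENNReal.ofReal_mul hS,
    ← ENNReal.ofReal_mul hS, ← ENNReal.ofReal_pow (mul_nonneg hS ht),
    ← ENNReal.ofReal_mul (by positivity)]
  congr 1
  obtain ⟨m, rfl⟩ : ∃ k, m = k + 1 := Nat.exists_eq_add_one.2 j.pos
  rw [Nat.add_sub_cancel]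
  ring

theorem setLIntegral_productWeight [NeZero n] [NeZero m] {t : ℝ} (ht : 0 ≤ t) :
    ∫⁻ y in polyball n m t, productWeight y = ENNReal.ofReal (sphereArea n ^ m * t ^ m) := by
  have h := setLIntegral_productWeight_mul_of_eq (n := n) ht (0 : Fin m) (fun _ => 1)
    measurable_const (b := t) (by simp)
  simp only [mul_one] at h
  rw [h, mul_assoc, ← pow_succ, Nat.sub_add_cancel (NeZero.one_le)]

theorem setLIntegral_productWeight_mul_rpow [NeZero n] {t : ℝ} (ht : 0 ≤ t) (j : Fin m) {κ : ℝ}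
    (hκ : -1 < κ) :
    ∫⁻ y in polyball n m t, productWeight y * ENNReal.ofReal ‖y j‖ ^ κ =
      ENNReal.ofReal (sphereArea n ^ m * t ^ (m - 1) * (t ^ (κ + 1) / (κ + 1))) := by
  refine setLIntegral_productWeight_mul_of_eq ht j (fun r => ENNReal.ofReal r ^ κ)
    (by fun_prop) ?_
  have h1 : ∫⁻ r in Ioc 0 t, ENNReal.ofReal r ^ κ = ∫⁻ r in Ioc 0 t, ENNReal.ofReal (r ^ κ) :=
    setLIntegral_congr_fun measurableSet_Ioc fun r hr => ENNReal.ofReal_rpow_of_pos hr.1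
  rw [h1, ← ofReal_integral_eq_lintegral_ofReal]
  · rw [← intervalIntegral.integral_of_le ht, integral_rpow (Or.inl hκ),
      Real.zero_rpow (by linarith), sub_zero]
  · exact (intervalIntegral.intervalIntegrable_rpow' hκ).1
  · filter_upwards [ae_restrict_mem measurableSet_Ioc] with r hr using Real.rpow_nonneg hr.1.le _

/-- The radial measure is `dr`, so the shell has mass proportional to its thickness `h`. -/
theorem setLIntegral_productWeight_annulus [NeZero n] {t h : ℝ} (ht : h ≤ t) (hh : 0 ≤ h)
    (j : Fin m) :
    ∫⁻ y in polyball n m t, productWeight y * (Ioi (t - h)).indicator 1 ‖y j‖ =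
      ENNReal.ofReal (sphereArea n ^ m * t ^ (m - 1) * h) := by
  refine setLIntegral_productWeight_mul_of_eq (hh.trans ht) j _
    (measurable_one.indicator measurableSet_Ioi) ?_
  rw [lintegral_indicator_one measurableSet_Ioi, Measure.restrict_apply measurableSet_Ioi]
  have : Ioi (t - h) ∩ Ioc 0 t = Ioc (t - h) t := by
    ext r
    simp only [mem_inter_iff, mem_Ioi, mem_Ioc]
    constructor
    · rintro ⟨h1, h2, h3⟩
      exact ⟨h1, h3⟩
    · rintro ⟨h1, h3⟩
      exact ⟨h1, by linarith, h3⟩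
  rw [this, Real.volume_Ioc, sub_sub_cancel]

theorem isCompact_polyball (t : ℝ) : IsCompact (polyball n m t) := by
  have : polyball n m t = Set.pi univ fun _ => Metric.closedBall 0 t := by
    ext; simp [polyball]
  rw [this]
  exact isCompact_univ_pi fun _ => isCompact_closedBall _ _

/-! ### Integrability and subtraction of constants -/

namespace IsMarcinkiewiczKernel

variable {β : ℝ} {Ω : (Fin m → EuclideanSpace ℝ (Fin n)) → 𝕜}

theorem enorm_kernel_le {A : ℝ} (hA₀ : 0 ≤ A) (hA : ∀ y, ‖Ω y‖ ≤ A)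
    (y : Fin m → EuclideanSpace ℝ (Fin n)) :
    ‖marcinkiewiczKernel Ω y‖ₑ ≤ ENNReal.ofReal A * productWeight y := by
  calc ‖marcinkiewiczKernel Ω y‖ₑ ≤ ENNReal.ofReal (A * (sumNorm y ^ (m * (n - 1)))⁻¹) := by
        rw [← ofReal_norm]
        exact ENNReal.ofReal_le_ofReal (norm_kernel_le hA y)
    _ ≤ _ := by
        rw [ENNReal.ofReal_mul hA₀]
        gcongr
        exact ofReal_inv_sumNorm_pow_le y

theorem integrableOn_kernel [NeZero n] [NeZero m] (hΩ : IsMarcinkiewiczKernel β Ω) (hβ : 0 < β)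
    {t : ℝ} (ht : 0 ≤ t) :
    IntegrableOn (marcinkiewiczKernel Ω) (polyball n m t) := by
  obtain ⟨A, hA0, hA⟩ := hΩ.exists_norm_le hβ
  refine ⟨(hΩ.measurable_kernel hβ).aestronglyMeasurable, ?_⟩
  refine (lintegral_mono fun y => enorm_kernel_le hA0.le hA y).trans_lt ?_
  rw [lintegral_const_mul _ measurable_productWeight, setLIntegral_productWeight ht,
    ← ENNReal.ofReal_mul hA0.le]
  exact ENNReal.ofReal_lt_top

theorem integrableOn_kernel_mul [NeZero n] [NeZero m] (hΩ : IsMarcinkiewiczKernel β Ω)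
    (hβ : 0 < β) {t : ℝ} (ht : 0 ≤ t) {Φ : (Fin m → EuclideanSpace ℝ (Fin n)) → 𝕜}
    (hΦ : Continuous Φ) :
    IntegrableOn (fun y => marcinkiewiczKernel Ω y * Φ y) (polyball n m t) :=
  (hΩ.integrableOn_kernel hβ ht).mul_continuousOn hΦ.continuousOn (isCompact_polyball t)

/-- Constants may be subtracted from the `fᵢ`, by the vanishing of `Ω` on spheres. -/
theorem integral_kernel_mul_prod_sub [NeZero n] [NeZero m] (hΩ : IsMarcinkiewiczKernel β Ω)
    (hβ : 0 < β) {t : ℝ} (ht : 0 ≤ t) (f : Fin m → EuclideanSpace ℝ (Fin n) → 𝕜)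
    (hf : ∀ i, Continuous (f i)) (c : Fin m → 𝕜) (x : EuclideanSpace ℝ (Fin n)) :
    ∫ y in polyball n m t, marcinkiewiczKernel Ω y * ∏ i, (f i (x - y i) - c i) =
      ∫ y in polyball n m t, marcinkiewiczKernel Ω y * ∏ i, f i (x - y i) := by
  classical
  simp_rw [sub_eq_add_neg (f _ _), Finset.prod_add, Finset.mul_sum]
  rw [integral_finsetSum _ fun s _ => hΩ.integrableOn_kernel_mul hβ ht (by fun_prop),
    Finset.sum_eq_single Finset.univ]
  · simp
  -- Every term of the expansion other than the full product omits some `f j`, hence does not depend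
  -- on `y j`.
  · intro s _ hs
    obtain ⟨j, hj⟩ : ∃ j, j ∉ s := by
      by_contra! h
      exact hs (Finset.eq_univ_of_forall h)
    refine hΩ.integral_mul_eq_zero t j _ fun y v => ?_
    congr 1
    refine Finset.prod_congr rfl fun i hi => ?_
    rw [Function.update_of_ne]
    rintro rfl
    exact hj hi
  · simp

end IsMarcinkiewiczKernel

theorem marcinkiewiczAverage_eq (Ω : (Fin m → EuclideanSpace ℝ (Fin n)) → 𝕜)
    (f : Fin m → EuclideanSpace ℝ (Fin n) → 𝕜) (t : ℝ) (x : EuclideanSpace ℝ (Fin n)) :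
    marcinkiewiczAverage Ω f t x = ((t ^ m)⁻¹ : ℝ) •
      ∫ y in polyball n m t, marcinkiewiczKernel Ω y * ∏ i, f i (x - y i) := by
  simp only [marcinkiewiczAverage, marcinkiewiczKernel, smul_mul_assoc]
  rfl

theorem prod_rpow_le_rpow_sum {a : Fin m → ℝ} (ha : ∀ i, 0 < a i) {r : Fin m → ℝ} {s : ℝ}
    (hr : ∀ i, 0 ≤ r i) (hrs : ∀ i, r i ≤ s) (hs : 0 < s) :
    ∏ i, r i ^ a i ≤ s ^ ∑ i, a i := by
  rw [Real.rpow_sum_of_pos hs]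
  exact Finset.prod_le_prod (fun i _ => Real.rpow_nonneg (hr i) _) fun i _ =>
    Real.rpow_le_rpow (hr i) (hrs i) (ha i).le

/-- The bound `s` is kept free because it is taken to be `t`, `|y⃗|` or `2t` in different places. -/
theorem norm_prod_sub_le {a L : Fin m → ℝ} (ha : ∀ i, 0 < a i) (hL : ∀ i, 0 ≤ L i)
    {f : Fin m → EuclideanSpace ℝ (Fin n) → 𝕜}
    (hf : ∀ i u v, ‖f i u - f i v‖ ≤ L i * ‖u - v‖ ^ a i)
    (x : EuclideanSpace ℝ (Fin n)) (y : Fin m → EuclideanSpace ℝ (Fin n)) {s : ℝ} (hs : 0 < s)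
    (hy : ∀ i, ‖y i‖ ≤ s) :
    ‖∏ i, (f i (x - y i) - f i x)‖ ≤ (∏ i, L i) * s ^ ∑ i, a i := by
  rw [norm_prod]
  calc ∏ i, ‖f i (x - y i) - f i x‖ ≤ ∏ i, (L i * ‖y i‖ ^ a i) := by
        refine Finset.prod_le_prod (fun _ _ => norm_nonneg _) fun i _ => ?_
        simpa using hf i (x - y i) x
    _ = (∏ i, L i) * ∏ i, ‖y i‖ ^ a i := Finset.prod_mul_distrib
    _ ≤ _ := by
        refine mul_le_mul_of_nonneg_left ?_ (Finset.prod_nonneg fun i _ => hL i)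
        exact prod_rpow_le_rpow_sum ha (fun _ => norm_nonneg _) hy hs

theorem continuous_of_norm_sub_le_rpow {E : Type*} [NormedAddCommGroup E] {f : E → 𝕜} {L a : ℝ}
    (ha : 0 < a) (hf : ∀ u v, ‖f u - f v‖ ≤ L * ‖u - v‖ ^ a) : Continuous f := by
  refine continuous_iff_continuousAt.2 fun v => ?_
  rw [ContinuousAt, tendsto_iff_norm_sub_tendsto_zero]
  have hc : ContinuousAt (fun u => L * ‖u - v‖ ^ a) v :=
    continuousAt_const.mul
      (ContinuousAt.rpow_const (by fun_prop) (Or.inr ha.le))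
  rw [ContinuousAt, sub_self, norm_zero, Real.zero_rpow ha.ne', mul_zero] at hc
  exact squeeze_zero (fun _ => norm_nonneg _) (fun u => hf u v) hc

/-! ### Estimates for `F_t` and for its differences -/

namespace IsMarcinkiewiczKernel

variable {β : ℝ} {Ω : (Fin m → EuclideanSpace ℝ (Fin n)) → 𝕜}

theorem norm_average_le [NeZero n] [NeZero m] (hΩ : IsMarcinkiewiczKernel β Ω) (hβ : 0 < β)
    {A : ℝ} (hA₀ : 0 ≤ A) (hA : ∀ y, ‖Ω y‖ ≤ A)
    {a L : Fin m → ℝ} (ha : ∀ i, 0 < a i) (hL : ∀ i, 0 ≤ L i)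
    {f : Fin m → EuclideanSpace ℝ (Fin n) → 𝕜}
    (hf : ∀ i u v, ‖f i u - f i v‖ ≤ L i * ‖u - v‖ ^ a i)
    {t : ℝ} (ht : 0 < t) (x : EuclideanSpace ℝ (Fin n)) :
    ‖marcinkiewiczAverage Ω f t x‖ ≤ A * sphereArea n ^ m * (∏ i, L i) * t ^ ∑ i, a i := by
  have hS := sphereArea_nonneg n
  have hP : 0 ≤ ∏ i, L i := Finset.prod_nonneg fun i _ => hL i
  have hfc : ∀ i, Continuous (f i) := fun i => continuous_of_norm_sub_le_rpow (ha i) (hf i)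
  rw [marcinkiewiczAverage_eq, ← hΩ.integral_kernel_mul_prod_sub hβ ht.le f hfc (fun i => f i x),
    norm_smul, Real.norm_of_nonneg (by positivity)]
  have h1 : ‖∫ y in polyball n m t,
      marcinkiewiczKernel Ω y * ∏ i, (f i (x - y i) - f i x)‖ ≤
      A * ((∏ i, L i) * t ^ ∑ i, a i) * (sphereArea n ^ m * t ^ m) := by
    rw [← ENNReal.ofReal_le_ofReal_iff (by positivity), ofReal_norm]
    refine (enorm_integral_le_lintegral_enorm _).trans ?_
    calc _ ≤ ∫⁻ y in polyball n m t,
          ENNReal.ofReal (A * ((∏ i, L i) * t ^ ∑ i, a i)) * productWeight y := by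
          refine setLIntegral_mono (by have := measurable_productWeight (n := n) (m := m); fun_prop)
            fun y hy => ?_
          rw [enorm_mul, ENNReal.ofReal_mul hA₀, mul_right_comm]
          refine mul_le_mul' (enorm_kernel_le hA₀ hA y) ?_
          rw [← ofReal_norm]
          exact ENNReal.ofReal_le_ofReal
            (norm_prod_sub_le ha hL hf x y ht (mem_polyball.1 hy))
      _ = _ := by
          rw [lintegral_const_mul _ measurable_productWeight, setLIntegral_productWeight ht.le,
            ← ENNReal.ofReal_mul (by positivity)]
  calc _ ≤ (t ^ m)⁻¹ * (A * ((∏ i, L i) * t ^ ∑ i, a i) * (sphereArea n ^ m * t ^ m)) := by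
        gcongr
    _ = _ := by field_simp

/-- The function dominating the difference of two truncated kernels. -/
noncomputable def dominator (c₁ c₂ κ h t : ℝ) (j₀ : Fin m)
    (y : Fin m → EuclideanSpace ℝ (Fin n)) : ℝ≥0∞ :=
  (polyball n m t).indicator (fun y =>
    ENNReal.ofReal c₁ * (productWeight y * ENNReal.ofReal ‖y j₀‖ ^ κ) +
    ENNReal.ofReal c₂ * ∑ j, productWeight y * (Ioi (t - h)).indicator 1 ‖y j‖) y

theorem measurable_dominator (c₁ c₂ κ h t : ℝ) (j₀ : Fin m) :
    Measurable (dominator (n := n) c₁ c₂ κ h t j₀) := by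
  refine Measurable.indicator ?_ (measurableSet_polyball t)
  have h1 := measurable_productWeight (n := n) (m := m)
  have h2 : ∀ j, Measurable fun y : Fin m → EuclideanSpace ℝ (Fin n) =>
      (Ioi (t - h)).indicator (1 : ℝ → ℝ≥0∞) ‖y j‖ := fun j =>
    (measurable_one.indicator measurableSet_Ioi).comp (by fun_prop)
  fun_prop

theorem lintegral_dominator [NeZero n] {c₁ c₂ κ h t : ℝ} (hc₁ : 0 ≤ c₁) (hc₂ : 0 ≤ c₂)
    (hκ : -1 < κ) (hh : 0 ≤ h) (ht : h ≤ t) (j₀ : Fin m) :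
    ∫⁻ y, dominator (n := n) c₁ c₂ κ h t j₀ y =
      ENNReal.ofReal (sphereArea n ^ m * t ^ (m - 1) *
        (c₁ * (t ^ (κ + 1) / (κ + 1)) + c₂ * (m * h))) := by
  have ht0 : 0 ≤ t := hh.trans ht
  have hS := sphereArea_nonneg n
  have hκ' : 0 < κ + 1 := by linarith
  have h1 := measurable_productWeight (n := n) (m := m)
  have h2 : ∀ j, Measurable fun y : Fin m → EuclideanSpace ℝ (Fin n) =>
      (Ioi (t - h)).indicator (1 : ℝ → ℝ≥0∞) ‖y j‖ := fun j =>
    (measurable_one.indicator measurableSet_Ioi).comp (by fun_prop)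
  unfold dominator
  rw [lintegral_indicator (measurableSet_polyball t), lintegral_add_left (by fun_prop),
    lintegral_const_mul _ (by fun_prop), lintegral_const_mul _ (by fun_prop),
    lintegral_finsetSum _ fun j _ => by fun_prop,
    setLIntegral_productWeight_mul_rpow ht0 j₀ hκ]
  simp_rw [setLIntegral_productWeight_annulus ht hh]
  rw [Finset.sum_const, Finset.card_univ, Fintype.card_fin, nsmul_eq_mul,
    ← ENNReal.ofReal_natCast, ← ENNReal.ofReal_mul (by positivity),
    ← ENNReal.ofReal_mul (by positivity), ← ENNReal.ofReal_mul (by positivity),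
    ← ENNReal.ofReal_add (by positivity) (by positivity)]
  congr 1
  ring

/-- As `κ ≤ 0`, the power of `|y⃗|` may be passed to a single coordinate, and the bound becomes a
product of one-variable functions. -/
theorem ofReal_inv_mul_rpow_le {κ : ℝ} (hκ : κ ≤ 0) {y : Fin m → EuclideanSpace ℝ (Fin n)}
    (hy : y ≠ 0) (j : Fin m) :
    ENNReal.ofReal ((sumNorm y ^ (m * (n - 1)))⁻¹ * sumNorm y ^ κ) ≤
      productWeight y * ENNReal.ofReal ‖y j‖ ^ κ := by
  have hr := sumNorm_pos.2 hy
  rw [ENNReal.ofReal_mul (by positivity), ← ENNReal.ofReal_rpow_of_pos hr]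
  refine mul_le_mul' (ofReal_inv_sumNorm_pow_le y) ?_
  rw [← neg_neg κ, ENNReal.rpow_neg, ENNReal.rpow_neg _ (-κ), ENNReal.inv_le_inv]
  exact ENNReal.rpow_le_rpow (ENNReal.ofReal_le_ofReal (norm_le_sumNorm y j)) (by linarith)

theorem enorm_truncated_sub_mul_le {A C : ℝ} (hA₀ : 0 ≤ A) (hA : ∀ y, ‖Ω y‖ ≤ A)
    (hC₀ : 0 ≤ C) {a : ℝ} (haβ : a < β)
    {h t : ℝ} (hh : 0 < h) (ht : h ≤ t) (j₀ : Fin m)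
    {y d : Fin m → EuclideanSpace ℝ (Fin n)} (hd : ∀ i, ‖d i‖ = h) (hy : y ≠ 0) (hyd : y + d ≠ 0)
    (hC : ‖marcinkiewiczKernel Ω y - marcinkiewiczKernel Ω (y + d)‖ * sumNorm y ^ a ≤
        C * sumNorm d ^ β * ((sumNorm y ^ (m * (n - 1)))⁻¹ * sumNorm y ^ (a - β) +
          (sumNorm (y + d) ^ (m * (n - 1)))⁻¹ * sumNorm (y + d) ^ (a - β)))
    {P : ℝ} (hP : 0 ≤ P) {g : 𝕜} (hg : ∀ s, 0 < s → (∀ i, ‖y i‖ ≤ s) → ‖g‖ ≤ P * s ^ a) :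
    ‖((polyball n m t).indicator (marcinkiewiczKernel Ω) y -
      (polyball n m t).indicator (marcinkiewiczKernel Ω) (y + d)) * g‖ₑ ≤
      dominator (P * (C * (m * h) ^ β)) (A * (P * (2 * t) ^ a)) (a - β) h t j₀ y +
      dominator (P * (C * (m * h) ^ β)) (A * (P * (2 * t) ^ a)) (a - β) h t j₀ (y + d) := by
  have hsd : sumNorm d = m * h := by simp [sumNorm, hd]
  have ht0 : 0 < t := hh.trans_le ht
  -- This covers the case where exactly one of `y`, `y + d` lies in the domain: a shift by `h`
  -- leaves the domain only from a point with some coordinate of norm above `t - h`.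
  have key : ∀ z : Fin m → EuclideanSpace ℝ (Fin n), z ∈ polyball n m t →
      (∃ j, t - h < ‖z j‖) → ‖g‖ ≤ P * (2 * t) ^ a →
      ‖marcinkiewiczKernel Ω z * g‖ₑ ≤
        dominator (P * (C * (m * h) ^ β)) (A * (P * (2 * t) ^ a)) (a - β) h t j₀ z := by
    rintro z hz ⟨j, hj⟩ hgz
    rw [dominator, indicator_of_mem hz]
    refine le_add_of_nonneg_of_le zero_le ?_
    calc ‖marcinkiewiczKernel Ω z * g‖ₑ
        ≤ (ENNReal.ofReal A * productWeight z) * ENNReal.ofReal (P * (2 * t) ^ a) := by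
          rw [enorm_mul]
          refine mul_le_mul' (enorm_kernel_le hA₀ hA z) ?_
          rw [← ofReal_norm]
          exact ENNReal.ofReal_le_ofReal hgz
      _ = ENNReal.ofReal (A * (P * (2 * t) ^ a)) *
          (productWeight z * (Ioi (t - h)).indicator 1 ‖z j‖) := by
          rw [indicator_of_mem (mem_Ioi.2 hj), Pi.one_apply, mul_one, ENNReal.ofReal_mul hA₀]
          ring
      _ ≤ _ := by
          gcongr
          exact Finset.single_le_sum
            (f := fun j => productWeight z * (Ioi (t - h)).indicator 1 ‖z j‖)
            (fun _ _ => zero_le) (Finset.mem_univ j)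
  by_cases h1 : y ∈ polyball n m t <;> by_cases h2 : y + d ∈ polyball n m t
  · rw [indicator_of_mem h1, indicator_of_mem h2]
    have hg1 := hg _ (sumNorm_pos.2 hy) (norm_le_sumNorm y)
    have hle : ‖(marcinkiewiczKernel Ω y - marcinkiewiczKernel Ω (y + d)) * g‖ ≤
        P * (C * (m * h) ^ β) * ((sumNorm y ^ (m * (n - 1)))⁻¹ * sumNorm y ^ (a - β) +
          (sumNorm (y + d) ^ (m * (n - 1)))⁻¹ * sumNorm (y + d) ^ (a - β)) := by
      rw [norm_mul]
      calc _ ≤ ‖marcinkiewiczKernel Ω y - marcinkiewiczKernel Ω (y + d)‖ *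
            (P * sumNorm y ^ a) := by gcongr
        _ = P * (‖marcinkiewiczKernel Ω y - marcinkiewiczKernel Ω (y + d)‖ *
            sumNorm y ^ a) := by ring
        _ ≤ _ := by
          rw [mul_assoc P]
          refine mul_le_mul_of_nonneg_left ?_ hP
          rw [← hsd]
          exact hC
    have hn1 := sumNorm_nonneg y
    have hn2 := sumNorm_nonneg (y + d)
    rw [← ofReal_norm]
    refine (ENNReal.ofReal_le_ofReal hle).trans ?_
    rw [ENNReal.ofReal_mul (by positivity), ENNReal.ofReal_add (by positivity) (by positivity),
      mul_add, dominator, dominator, indicator_of_mem h1, indicator_of_mem h2]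
    refine add_le_add ?_ ?_ <;> refine le_add_of_le_of_nonneg ?_ zero_le <;> gcongr
    · exact ofReal_inv_mul_rpow_le (by linarith) hy j₀
    · exact ofReal_inv_mul_rpow_le (by linarith) hyd j₀
  · rw [indicator_of_mem h1, indicator_of_notMem h2, sub_zero]
    refine (key y h1 ?_ ?_).trans le_self_add
    · rw [mem_polyball] at h2
      push Not at h2
      obtain ⟨j, hj⟩ := h2
      refine ⟨j, ?_⟩
      have := norm_add_le (y j) (d j)
      rw [hd j] at this
      rw [Pi.add_apply] at hj
      linarith
    · exact hg _ (by positivity) fun i => (mem_polyball.1 h1 i).trans (by linarith)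
  · rw [indicator_of_notMem h1, indicator_of_mem h2, zero_sub, neg_mul, enorm_neg]
    have hdy : ∀ i, ‖y i‖ ≤ ‖(y + d) i‖ + h := by
      intro i
      have := norm_sub_le (y i + d i) (d i)
      rwa [add_sub_cancel_right, hd i] at this
    refine (key (y + d) h2 ?_ ?_).trans le_add_self
    · rw [mem_polyball] at h1
      push Not at h1
      obtain ⟨j, hj⟩ := h1
      exact ⟨j, by linarith [hdy j]⟩
    -- Here `‖y i‖ ≤ t + h ≤ 2t`, which is why the shell term carries `(2t) ^ a`.
    · exact hg _ (by positivity) fun i => by linarith [hdy i, mem_polyball.1 h2 i]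
  · rw [indicator_of_notMem h1, indicator_of_notMem h2]
    simp

theorem exists_norm_average_sub_le [NeZero n] [NeZero m] (hΩ : IsMarcinkiewiczKernel β Ω)
    (hβ₀ : 0 < β) (hβ₁ : β ≤ 1) {a : Fin m → ℝ} (ha : ∀ i, 0 < a i) (haβ : ∑ i, a i < β) :
    ∃ C : ℝ, 0 ≤ C ∧ ∀ (L : Fin m → ℝ) (f : Fin m → EuclideanSpace ℝ (Fin n) → 𝕜),
      (∀ i, 0 ≤ L i) → (∀ i u v, ‖f i u - f i v‖ ≤ L i * ‖u - v‖ ^ a i) →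
      ∀ (x z : EuclideanSpace ℝ (Fin n)) (t : ℝ), x ≠ z → ‖z - x‖ ≤ t →
      ‖marcinkiewiczAverage Ω f t x - marcinkiewiczAverage Ω f t z‖ ≤
        C * (∏ i, L i) * (‖z - x‖ ^ β * t ^ (∑ i, a i - β)) := by
  obtain ⟨A, hA0, hA⟩ := hΩ.exists_norm_le hβ₀
  obtain ⟨C, hC0, hC⟩ := hΩ.exists_norm_kernel_sub_mul_le hβ₀ hβ₁
  set s := ∑ i, a i with hs
  have hs0 : 0 < s := Finset.sum_pos (fun i _ => ha i) ⟨0, Finset.mem_univ _⟩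
  have hS := sphereArea_nonneg n
  have hκ : 0 < s - β + 1 := by linarith
  refine ⟨2 * sphereArea n ^ m * (C * m ^ β / (s - β + 1) + A * 2 ^ s * m), by positivity,
    fun L f hL hf x z t hxz ht => ?_⟩
  have hP : 0 ≤ ∏ i, L i := Finset.prod_nonneg fun i _ => hL i
  have hfc : ∀ i, Continuous (f i) := fun i => continuous_of_norm_sub_le_rpow (ha i) (hf i)
  have hh : 0 < ‖z - x‖ := norm_pos_iff.2 (sub_ne_zero.2 hxz.symm)
  set h := ‖z - x‖ with hhdef
  have ht0 : 0 < t := hh.trans_le ht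
  set d : Fin m → EuclideanSpace ℝ (Fin n) := fun _ => z - x with hd
  set G : (Fin m → EuclideanSpace ℝ (Fin n)) → 𝕜 := fun y => ∏ i, (f i (x - y i) - f i x) with hG
  set k := (polyball n m t).indicator (marcinkiewiczKernel Ω) with hk
  have hGc : Continuous G := by fun_prop
  have hind : ∀ Φ : (Fin m → EuclideanSpace ℝ (Fin n)) → 𝕜,
      (polyball n m t).indicator (fun y => marcinkiewiczKernel Ω y * Φ y) = fun y => k y * Φ y := by
    intro Φ
    funext y
    rw [hk, indicator_mul_left]
  have hx : ∫ y in polyball n m t, marcinkiewiczKernel Ω y * ∏ i, f i (x - y i) =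
      ∫ y, k y * G y := by
    rw [← hΩ.integral_kernel_mul_prod_sub hβ₀ ht0.le f hfc (fun i => f i x),
      ← integral_indicator (measurableSet_polyball t), hind]
  -- The shift is chosen so that `z - (y + d) i = x - y i`; the constants subtracted at `z` are also
  -- the values at `x`.
  have hGd : ∀ y : Fin m → EuclideanSpace ℝ (Fin n),
      ∏ i, (f i (z - (y + d) i) - f i x) = G y := by
    intro y
    have : ∀ i, z - (y i + (z - x)) = x - y i := fun i => by abel
    simp only [hG, hd, Pi.add_apply, this]
  have hz : ∫ y in polyball n m t, marcinkiewiczKernel Ω y * ∏ i, f i (z - y i) =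
      ∫ y, k (y + d) * G y := by
    rw [← hΩ.integral_kernel_mul_prod_sub hβ₀ ht0.le f hfc (fun i => f i x),
      ← integral_indicator (measurableSet_polyball t), hind, ← integral_add_right_eq_self _ d]
    simp_rw [hGd]
  have hi1 : Integrable fun y => k y * G y := by
    rw [← hind, integrable_indicator_iff (measurableSet_polyball t)]
    exact hΩ.integrableOn_kernel_mul hβ₀ ht0.le hGc
  have hi2 : Integrable fun y => k (y + d) * G y := by
    have : Integrable fun y => k y * ∏ i, (f i (z - y i) - f i x) := by
      rw [← hind, integrable_indicator_iff (measurableSet_polyball t)]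
      exact hΩ.integrableOn_kernel_mul hβ₀ ht0.le (by fun_prop)
    have h2 := this.comp_add_right d
    simpa only [hGd] using h2
  set P := ∏ i, L i
  set D := dominator (n := n) (P * (C * (m * h) ^ β)) (A * (P * (2 * t) ^ s)) (s - β) h t
    (0 : Fin m) with hD
  have hDm : Measurable D := measurable_dominator _ _ _ _ _ _
  have hbound : ‖∫ y, (k y - k (y + d)) * G y‖ ≤ 2 * (sphereArea n ^ m * t ^ (m - 1) *
        (P * (C * (m * h) ^ β) * (t ^ (s - β + 1) / (s - β + 1)) +
          A * (P * (2 * t) ^ s) * (m * h))) := by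
    rw [← ENNReal.ofReal_le_ofReal_iff (by positivity), ofReal_norm]
    calc _ ≤ ∫⁻ y, ‖(k y - k (y + d)) * G y‖ₑ := enorm_integral_le_lintegral_enorm _
      _ ≤ ∫⁻ y, (D y + D (y + d)) := by
          refine lintegral_mono_ae ?_
          -- The kernel estimate excludes the two singular points `0` and `-d`, which are null.
          have hne : ∀ v : Fin m → EuclideanSpace ℝ (Fin n), ∀ᵐ y, y ≠ v := fun v => by
            have : NullSingletonClass (volume : Measure (Fin m → EuclideanSpace ℝ (Fin n))) :=
              Measure.pi_nullSingletonClass 0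
            exact Measure.ae_ne volume v
          filter_upwards [hne 0, hne (-d)] with y hy hyd
          have hyd' : y + d ≠ 0 := fun hc => hyd (eq_neg_of_add_eq_zero_left hc)
          refine enorm_truncated_sub_mul_le hA0.le hA hC0.le haβ hh ht 0 (fun _ => rfl) hy hyd'
            (hC s hs0 haβ y d hy hyd') hP fun r hr hyr => ?_
          exact norm_prod_sub_le ha hL hf x y hr hyr
      _ = ENNReal.ofReal (2 * (sphereArea n ^ m * t ^ (m - 1) *
        (P * (C * (m * h) ^ β) * (t ^ (s - β + 1) / (s - β + 1)) +
          A * (P * (2 * t) ^ s) * (m * h)))) := by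
          rw [lintegral_add_left hDm, lintegral_add_right_eq_self D d, ← two_mul,
            lintegral_dominator (by positivity) (by positivity) (by linarith) hh.le ht,
            ENNReal.ofReal_mul zero_le_two, ENNReal.ofReal_ofNat]
  rw [marcinkiewiczAverage_eq, marcinkiewiczAverage_eq, hx, hz, ← smul_sub,
    ← integral_sub hi1 hi2]
  simp_rw [← sub_mul]
  rw [norm_smul, Real.norm_of_nonneg (by positivity)]
  have e1 : (t ^ m)⁻¹ * t ^ (m - 1) = t⁻¹ := by
    obtain ⟨l, hl⟩ : ∃ l, m = l + 1 := Nat.exists_eq_add_one.2 (NeZero.pos m)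
    rw [hl, Nat.add_sub_cancel, pow_succ]
    field_simp
  have e2 : t⁻¹ * t ^ (s - β + 1) = t ^ (s - β) := by
    rw [Real.rpow_add_one ht0.ne']
    field_simp
  -- The shell term is of relative size `h / t ≤ 1`, which is at most `(h / t) ^ β` because `β ≤ 1`.
  have e3 : t⁻¹ * (t ^ s * h) ≤ h ^ β * t ^ (s - β) := by
    have hq : h / t ≤ (h / t) ^ β :=
      Real.self_le_rpow_of_le_one (by positivity) ((div_le_one ht0).2 ht) hβ₁
    calc t⁻¹ * (t ^ s * h) = t ^ s * (h / t) := by ring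
      _ ≤ t ^ s * (h / t) ^ β := by gcongr
      _ = _ := by
        rw [Real.div_rpow hh.le ht0.le, Real.rpow_sub ht0]
        ring
  have e4 : ((m : ℝ) * h) ^ β = m ^ β * h ^ β := Real.mul_rpow (by positivity) hh.le
  have e5 : (2 * t) ^ s = 2 ^ s * t ^ s := Real.mul_rpow (by positivity) ht0.le
  calc _ ≤ (t ^ m)⁻¹ * (2 * (sphereArea n ^ m * t ^ (m - 1) *
        (P * (C * (m * h) ^ β) * (t ^ (s - β + 1) / (s - β + 1)) +
          A * (P * (2 * t) ^ s) * (m * h)))) := by gcongr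
    _ = 2 * sphereArea n ^ m * ((t ^ m)⁻¹ * t ^ (m - 1)) * P *
        (C * m ^ β / (s - β + 1) * (h ^ β * t ^ (s - β + 1)) +
          A * 2 ^ s * m * (t ^ s * h)) := by
        rw [e4, e5]
        ring
    _ = 2 * sphereArea n ^ m * P * (C * m ^ β / (s - β + 1) * (h ^ β * t ^ (s - β)) +
          A * 2 ^ s * m * (t⁻¹ * (t ^ s * h))) := by
        rw [e1, ← e2]
        ring
    _ ≤ 2 * sphereArea n ^ m * P * (C * m ^ β / (s - β + 1) * (h ^ β * t ^ (s - β)) +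
          A * 2 ^ s * m * (h ^ β * t ^ (s - β))) := by gcongr
    _ = _ := by ring

end IsMarcinkiewiczKernel

/-! ### Lipschitz seminorms and the square function -/

theorem edist_le_of_lipNorm_le {Y : Type*} [PseudoEMetricSpace Y] {r : ℝ} {g : EuclideanSpace ℝ (Fin n) → Y}
    {c : ℝ≥0∞} (h : lipNorm r g ≤ c) {x z : EuclideanSpace ℝ (Fin n)} (hxz : x ≠ z) :
    edist (g x) (g z) ≤ c * edist x z ^ r := by
  have h0 : edist x z ^ r ≠ 0 := by
    rw [Ne, ENNReal.rpow_eq_zero_iff]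
    simp [hxz, edist_ne_top]
  have h1 : edist x z ^ r ≠ ∞ := by
    rw [Ne, ENNReal.rpow_eq_top_iff]
    simp [hxz, edist_ne_top]
  rw [← ENNReal.div_le_iff h0 h1]
  refine le_trans ?_ h
  unfold lipNorm
  exact le_iSup_of_le x (le_iSup_of_le z (le_iSup_of_le hxz le_rfl))

theorem norm_sub_le_of_lipNorm_lt_top {r : ℝ} (hr : 0 < r) {g : EuclideanSpace ℝ (Fin n) → 𝕜}
    (hg : lipNorm r g < ∞) (u v : EuclideanSpace ℝ (Fin n)) :
    ‖g u - g v‖ ≤ (lipNorm r g).toReal * ‖u - v‖ ^ r := by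
  by_cases huv : u = v
  · subst huv
    simp [Real.zero_rpow hr.ne']
  have hpos : 0 < ‖u - v‖ := norm_pos_iff.2 (sub_ne_zero.2 huv)
  have h := edist_le_of_lipNorm_le (le_refl (lipNorm r g)) huv
  rw [edist_dist, edist_dist, dist_eq_norm, dist_eq_norm, ENNReal.ofReal_rpow_of_pos hpos,
    ← ENNReal.ofReal_toReal hg.ne, ← ENNReal.ofReal_mul ENNReal.toReal_nonneg] at h
  exact (ENNReal.ofReal_le_ofReal_iff (by positivity)).1 h

theorem ENNReal.edist_le_of_le_add {a b c : ℝ≥0∞} (ha : a ≠ ∞) (hb : b ≠ ∞) (h₁ : a ≤ b + c)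
    (h₂ : b ≤ a + c) : edist a b ≤ c := by
  lift a to ℝ≥0 using ha
  lift b to ℝ≥0 using hb
  change edist a b ≤ c
  rcases eq_or_ne c ∞ with rfl | hc
  · exact le_top
  lift c to ℝ≥0 using hc
  norm_cast at h₁ h₂
  rw [edist_nndist, ENNReal.coe_le_coe, ← NNReal.coe_le_coe, coe_nndist, NNReal.dist_eq, abs_le]
  have h₁' : (a : ℝ) ≤ b + c := mod_cast h₁
  have h₂' : (b : ℝ) ≤ a + c := mod_cast h₂
  constructor <;> linarith

theorem IsMarcinkiewiczKernel.stronglyMeasurable_average {β : ℝ}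
    {Ω : (Fin m → EuclideanSpace ℝ (Fin n)) → 𝕜} (hΩ : IsMarcinkiewiczKernel β Ω) (hβ : 0 < β)
    {f : Fin m → EuclideanSpace ℝ (Fin n) → 𝕜} (hf : ∀ i, Continuous (f i))
    (x : EuclideanSpace ℝ (Fin n)) :
    StronglyMeasurable fun t => marcinkiewiczAverage Ω f t x := by
  simp_rw [marcinkiewiczAverage_eq]
  refine StronglyMeasurable.smul (by fun_prop : Measurable _).stronglyMeasurable ?_
  have hK := hΩ.measurable_kernel hβ
  -- The domain depends on `t`; as an indicator on the product space it gives a jointly measurable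
  -- integrand.
  have hset : MeasurableSet {p : ℝ × (Fin m → EuclideanSpace ℝ (Fin n)) |
      p.2 ∈ polyball n m p.1} := by
    simp_rw [mem_polyball, ofPred_forall]
    exact .iInter fun i => measurableSet_le (by fun_prop) (by fun_prop)
  have hm : Measurable fun p : ℝ × (Fin m → EuclideanSpace ℝ (Fin n)) =>
      marcinkiewiczKernel Ω p.2 * ∏ i, f i (x - p.2 i) := by
    have : Continuous fun y : Fin m → EuclideanSpace ℝ (Fin n) => ∏ i, f i (x - y i) := by
      fun_prop
    exact (hK.comp measurable_snd).mul (this.measurable.comp measurable_snd)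
  have h := (hm.indicator hset).stronglyMeasurable
  have h2 := StronglyMeasurable.integral_prod_right'
    (ν := (volume : Measure (Fin m → EuclideanSpace ℝ (Fin n)))) h
  convert h2 using 2 with t
  rw [← integral_indicator (measurableSet_polyball t)]
  rfl

/-- The integral is split at `t = h`: `t ^ (2a - 1)` is integrable at `0` since `a > 0`, and `t ^
(2(a - β) - 1)` at infinity since `a < β`. Both pieces scale like `h ^ (2a)`. -/
theorem setLIntegral_Ioi_sq_div_le {F : ℝ → 𝕜} {M a β h : ℝ} (hh : 0 < h) (ha : 0 < a)
    (haβ : a < β) (h₁ : ∀ t, 0 < t → ‖F t‖ ≤ M * t ^ a)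
    (h₂ : ∀ t, h ≤ t → ‖F t‖ ≤ M * (h ^ β * t ^ (a - β))) :
    ∫⁻ t in Ioi (0 : ℝ), ‖F t‖ₑ ^ 2 / ENNReal.ofReal t ≤
      ENNReal.ofReal ((M * h ^ a) ^ 2 * (1 / (2 * a) + 1 / (2 * (β - a)))) := by
  have hδ : 0 < β - a := sub_pos.2 haβ
  have sq_le : ∀ {t b : ℝ}, 0 < t → ‖F t‖ ≤ b →
      ‖F t‖ₑ ^ 2 / ENNReal.ofReal t ≤ ENNReal.ofReal (b ^ 2 / t) := by
    intro t b ht hb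
    rw [← ofReal_norm, ← ENNReal.ofReal_pow (norm_nonneg _), ← ENNReal.ofReal_div_of_pos ht]
    gcongr
  have hp : ∀ {t : ℝ} (c : ℝ), 0 < t → (t ^ c) ^ 2 / t = t ^ (2 * c - 1) := by
    intro t c ht
    rw [Real.rpow_sub_one ht.ne', mul_comm, Real.rpow_mul ht.le, Real.rpow_two]
  have small : ∫⁻ t in Ioc (0 : ℝ) h, ‖F t‖ₑ ^ 2 / ENNReal.ofReal t ≤
      ENNReal.ofReal ((M * h ^ a) ^ 2 * (1 / (2 * a))) := by
    calc _ ≤ ∫⁻ t in Ioc (0 : ℝ) h, ENNReal.ofReal (M ^ 2 * t ^ (2 * a - 1)) := by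
          refine setLIntegral_mono (by fun_prop) fun t ht => ?_
          refine (sq_le ht.1 (h₁ t ht.1)).trans_eq ?_
          rw [mul_pow, mul_div_assoc, hp a ht.1]
      _ = ENNReal.ofReal (∫ t in Ioc (0 : ℝ) h, M ^ 2 * t ^ (2 * a - 1)) := by
          rw [ofReal_integral_eq_lintegral_ofReal]
          · exact ((intervalIntegral.intervalIntegrable_rpow' (by linarith)).1).const_mul _
          · filter_upwards [ae_restrict_mem measurableSet_Ioc] with t ht
            have := Real.rpow_nonneg ht.1.le (2 * a - 1)
            simp only [Pi.zero_apply]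
            positivity
      _ = _ := by
          rw [integral_const_mul, ← intervalIntegral.integral_of_le hh.le,
            integral_rpow (Or.inl (by linarith)), Real.zero_rpow (by linarith), sub_zero,
            sub_add_cancel, mul_pow, ← Real.rpow_natCast (h ^ a), ← Real.rpow_mul hh.le]
          congr 1
          rw [Nat.cast_ofNat, mul_comm a 2]
          ring
  have large : ∫⁻ t in Ioi h, ‖F t‖ₑ ^ 2 / ENNReal.ofReal t ≤
      ENNReal.ofReal ((M * h ^ a) ^ 2 * (1 / (2 * (β - a)))) := by
    have hexp : 2 * (a - β) - 1 < -1 := by linarith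
    calc _ ≤ ∫⁻ t in Ioi h, ENNReal.ofReal ((M * h ^ β) ^ 2 * t ^ (2 * (a - β) - 1)) := by
          refine setLIntegral_mono (by fun_prop) fun t ht => ?_
          have ht0 : 0 < t := hh.trans ht
          refine (sq_le ht0 (h₂ t (le_of_lt ht))).trans_eq ?_
          rw [← mul_assoc, mul_pow, mul_div_assoc, hp (a - β) ht0]
      _ = ENNReal.ofReal (∫ t in Ioi h, (M * h ^ β) ^ 2 * t ^ (2 * (a - β) - 1)) := by
          rw [ofReal_integral_eq_lintegral_ofReal]
          · exact (integrableOn_Ioi_rpow_of_lt hexp hh).const_mul _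
          · filter_upwards [ae_restrict_mem measurableSet_Ioi] with t ht
            have := Real.rpow_nonneg (hh.trans ht).le (2 * (a - β) - 1)
            simp only [Pi.zero_apply]
            positivity
      _ = _ := by
          rw [integral_const_mul, integral_Ioi_rpow_of_lt hexp hh, sub_add_cancel]
          have e : h ^ a = h ^ β * h ^ (a - β) := by
            rw [← Real.rpow_add hh]
            congr 1
            ring
          have e2 : h ^ (2 * (a - β)) = (h ^ (a - β)) ^ 2 := by
            rw [mul_comm, Real.rpow_mul hh.le, Real.rpow_two]
          congr 1
          have hne : a - β ≠ 0 := by linarith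
          have hne' : β - a ≠ 0 := hδ.ne'
          rw [e2, e]
          have e3 : -(h ^ (a - β)) ^ 2 / (2 * (a - β)) =
              (h ^ (a - β)) ^ 2 * (1 / (2 * (β - a))) := by
            rw [← neg_sub β a]
            field_simp
          rw [e3]
          ring
  rw [← Ioc_union_Ioi_eq_Ioi hh.le, lintegral_union measurableSet_Ioi (Ioc_disjoint_Ioi le_rfl),
    mul_add, ENNReal.ofReal_add (by positivity) (by positivity)]
  exact add_le_add small large

theorem marcinkiewicz_le_add {Ω : (Fin m → EuclideanSpace ℝ (Fin n)) → 𝕜}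
    {f : Fin m → EuclideanSpace ℝ (Fin n) → 𝕜}
    (hm : ∀ x, StronglyMeasurable fun t => marcinkiewiczAverage Ω f t x)
    (x z : EuclideanSpace ℝ (Fin n)) :
    marcinkiewicz Ω f x ≤ marcinkiewicz Ω f z +
      (∫⁻ t in Ioi (0 : ℝ), ‖marcinkiewiczAverage Ω f t x - marcinkiewiczAverage Ω f t z‖ₑ ^ 2 /
        ENNReal.ofReal t) ^ (1 / 2 : ℝ) := by
  -- The weight `1 / t` is absorbed as `t ^ (-1/2)` into the function, so that Minkowski's
  -- inequality applies with Lebesgue measure.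
  have e : ∀ (b : ℝ≥0∞) (t : ℝ),
      b ^ 2 / ENNReal.ofReal t = (b * ENNReal.ofReal t ^ (-(1 / 2) : ℝ)) ^ (2 : ℝ) := by
    intro b t
    rw [ENNReal.mul_rpow_of_nonneg _ _ zero_le_two, ← ENNReal.rpow_mul, ENNReal.rpow_two]
    norm_num
    rw [ENNReal.rpow_neg_one, div_eq_mul_inv]
  simp only [marcinkiewicz, e]
  have m1 := (hm z).enorm
  have m2 := ((hm x).sub (hm z)).enorm
  refine le_trans ?_ (ENNReal.lintegral_Lp_add_le (p := 2) ?_ ?_ one_le_two)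
  · gcongr with t
    rw [Pi.add_apply, ← add_mul]
    gcongr
    have := enorm_add_le (marcinkiewiczAverage Ω f t z)
      (marcinkiewiczAverage Ω f t x - marcinkiewiczAverage Ω f t z)
    rwa [add_sub_cancel] at this
  · exact (m1.mul (by fun_prop)).aemeasurable
  · exact (m2.mul (by fun_prop)).aemeasurable

theorem IsMarcinkiewiczKernel.exists_marcinkiewicz_le_add [NeZero n] [NeZero m] {β : ℝ}
    {Ω : (Fin m → EuclideanSpace ℝ (Fin n)) → 𝕜} (hΩ : IsMarcinkiewiczKernel β Ω)
    (hβ₀ : 0 < β) (hβ₁ : β ≤ 1) {a : Fin m → ℝ} (ha : ∀ i, 0 < a i) (haβ : ∑ i, a i < β) :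
    ∃ C : ℝ, 0 < C ∧ ∀ (L : Fin m → ℝ) (f : Fin m → EuclideanSpace ℝ (Fin n) → 𝕜),
      (∀ i, 0 ≤ L i) → (∀ i u v, ‖f i u - f i v‖ ≤ L i * ‖u - v‖ ^ a i) →
      ∀ x z : EuclideanSpace ℝ (Fin n), x ≠ z →
        marcinkiewicz Ω f x ≤ marcinkiewicz Ω f z +
          ENNReal.ofReal (C * (∏ i, L i) * ‖z - x‖ ^ ∑ i, a i) := by
  obtain ⟨A, hA0, hA⟩ := hΩ.exists_norm_le hβ₀
  obtain ⟨C, hC0, hC⟩ := hΩ.exists_norm_average_sub_le hβ₀ hβ₁ ha haβ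
  set s := ∑ i, a i with hs
  have hs0 : 0 < s := Finset.sum_pos (fun i _ => ha i) ⟨0, Finset.mem_univ _⟩
  have hδ : 0 < β - s := sub_pos.2 haβ
  have hS := sphereArea_nonneg n
  -- `B` exceeds both the constant of the trivial bound on the difference and that of the refined
  -- one; the `1` keeps it positive.
  set B := 2 * (A * sphereArea n ^ m) + C + 1 with hB
  have hB0 : 0 < B := by positivity
  set q := 1 / (2 * s) + 1 / (2 * (β - s)) with hq
  have hq0 : 0 < q := by positivity
  refine ⟨B * √q, by positivity, fun L f hL hf x z hxz => ?_⟩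
  have hP : 0 ≤ ∏ i, L i := Finset.prod_nonneg fun i _ => hL i
  have hfc : ∀ i, Continuous (f i) := fun i => continuous_of_norm_sub_le_rpow (ha i) (hf i)
  have hh : 0 < ‖z - x‖ := norm_pos_iff.2 (sub_ne_zero.2 hxz.symm)
  refine (marcinkiewicz_le_add (fun x => hΩ.stronglyMeasurable_average hβ₀ hfc x) x z).trans ?_
  gcongr
  set P := ∏ i, L i
  set h := ‖z - x‖
  have key := setLIntegral_Ioi_sq_div_le
    (F := fun t => marcinkiewiczAverage Ω f t x - marcinkiewiczAverage Ω f t z)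
    (M := B * P) hh hs0 haβ ?_ ?_
  · calc _ ≤ ENNReal.ofReal ((B * P * h ^ s) ^ 2 * q) ^ (1 / 2 : ℝ) :=
          ENNReal.rpow_le_rpow key (by norm_num)
      _ = _ := by
          rw [ENNReal.ofReal_rpow_of_nonneg (by positivity) (by norm_num), ← Real.sqrt_eq_rpow,
            Real.sqrt_mul (by positivity), Real.sqrt_sq (by positivity)]
          congr 1
          ring
  · intro t ht
    have b1 := hΩ.norm_average_le hβ₀ hA0.le hA ha hL hf ht x
    have b2 := hΩ.norm_average_le hβ₀ hA0.le hA ha hL hf ht z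
    calc _ ≤ A * sphereArea n ^ m * P * t ^ s + A * sphereArea n ^ m * P * t ^ s :=
          (norm_sub_le _ _).trans (add_le_add b1 b2)
      _ = 2 * (A * sphereArea n ^ m) * P * t ^ s := by ring
      _ ≤ B * P * t ^ s := by
          gcongr
          linarith
  · intro t ht
    refine (hC L f hL hf x z t hxz ht).trans ?_
    have ht0 : 0 < t := hh.trans_le ht
    gcongr
    have : 0 ≤ A * sphereArea n ^ m := by positivity
    linarith

end Marcinkiewicz

/-! ### The dichotomy and the Lipschitz bound -/

theorem theorem1p3 {𝕜 : Type*} [RCLike 𝕜] (n m : ℕ) (hn : 1 ≤ n) (hm : 1 ≤ m)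
    (β : ℝ) (hβ₀ : 0 < β) (hβ₁ : β < 1)
    (Ω : (Fin m → EuclideanSpace ℝ (Fin n)) → 𝕜) (hΩ : IsMarcinkiewiczKernel β Ω)
    (α : Fin m → ℝ) (hα : ∀ j, 0 < α j) (hαβ : ∑ j, α j < β / 2) :
    ∃ C : ℝ≥0, 0 < C ∧ ∀ f : Fin m → EuclideanSpace ℝ (Fin n) → 𝕜,
      (∀ j, lipNorm (α j) (f j) < ∞) →
        (∀ x, marcinkiewicz Ω f x = ∞) ∨
        ((∀ᵐ x, marcinkiewicz Ω f x < ∞) ∧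
          lipNorm (∑ j, α j) (marcinkiewicz Ω f) ≤ C * ∏ j, lipNorm (α j) (f j)) := by
  have : NeZero n := ⟨by lia⟩
  have : NeZero m := ⟨by lia⟩
  obtain ⟨C, hC0, hC⟩ := hΩ.exists_marcinkiewicz_le_add hβ₀ hβ₁.le hα (by linarith)
  refine ⟨C.toNNReal, Real.toNNReal_pos.2 hC0, fun f hf => ?_⟩
  rw [or_iff_not_imp_left]
  intro hfin
  push Not at hfin
  obtain ⟨x₀, hx₀⟩ := hfin
  have hle := hC (fun j => (lipNorm (α j) (f j)).toReal) f (fun _ => ENNReal.toReal_nonneg)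
    fun j => norm_sub_le_of_lipNorm_lt_top (hα j) (hf j)
  -- One finite value makes `μ(f⃗)` finite everywhere, so the `edist` below is the ordinary
  -- distance.
  have hfinite : ∀ x, marcinkiewicz Ω f x < ∞ := by
    intro x
    by_cases hx : x = x₀
    · subst hx
      exact hx₀.lt_top
    · exact (hle x x₀ hx).trans_lt (ENNReal.add_lt_top.2 ⟨hx₀.lt_top, ENNReal.ofReal_lt_top⟩)
  refine ⟨.of_forall hfinite, ?_⟩
  refine iSup_le fun x => iSup_le fun z => iSup_le fun hxz => ENNReal.div_le_of_le_mul ?_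
  have hpos : 0 < ‖x - z‖ := norm_pos_iff.2 (sub_ne_zero.2 hxz)
  have hconst : ENNReal.ofReal (C * (∏ j, (lipNorm (α j) (f j)).toReal) * ‖x - z‖ ^ ∑ j, α j) =
      (C.toNNReal : ℝ≥0∞) * (∏ j, lipNorm (α j) (f j)) * edist x z ^ ∑ j, α j := by
    rw [ENNReal.ofReal_mul (by positivity), ENNReal.ofReal_mul hC0.le,
      ENNReal.ofReal_prod_of_nonneg fun _ _ => ENNReal.toReal_nonneg,
      ← ENNReal.ofReal_rpow_of_pos hpos, edist_dist, dist_eq_norm]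
    simp_rw [fun j => ENNReal.ofReal_toReal (hf j).ne]
    rfl
  rw [← hconst]
  refine ENNReal.edist_le_of_le_add (hfinite x).ne (hfinite z).ne ?_ (hle z x hxz.symm)
  rw [norm_sub_rev]
  exact hle x z hxz
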